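/- Let $C_1,C_2,c,a>0$, $\Omega\in\mathbb{R}\setminus\{0\}$ and $X_d=(x_d,y_d)\in\mathbb{R}^2$, and let $J(x,y)=C_1(x-x_d)^4+C_2(y-y_d)^4$. For $\varepsilon>0$ consider the unicycle extremum seeking system without high-pass filter $$\dot x=v\cos(\Omega t),\qquad \dot y=v\sin(\Omega t),\qquad v=2\Big(\frac{2\pi}{\varepsilon}\Big)^{3/4}\Big(3c\,J(x,y)\sin\frac{6\pi t}{\varepsilon}+a\cos\frac{2\pi t}{\varepsilon}\Big).$$ For every compact set $D\subset\mathbb{R}^2$ with $X_d\in D$ this system is practically exponentially stable: there are constants $q_1,q_2>0$, a number $\varepsilon_0>0$ and a function $d$ with $d(\varepsilon)\to0$ as $\varepsilon\to0^+$ such that, for all $\varepsilon\in(0,\varepsilon_0)$, all $X_0\in D$ and all $T>0$, the solution $X(t)=(x(t),y(t))$ with $X(0)=X_0$ exists on $[0,T]$ and satisfies $$\|X(t)-X_d\|\le q_1\,\|X_0-X_d\|\,e^{-q_2t}+d(\varepsilon)\qquad\text{for all }t\in[0,T].$$ Here $q_1,q_2$ do not depend on $\varepsilon$, $X_0$ or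 $T$, and $d$ and $\varepsilon_0$ do not depend on $X_0$ or $T$. -/

import Mathlib

open Filter Topology

noncomputable section

/-- The position plane, with the Euclidean norm. -/
abbrev Plane : Type := EuclideanSpace ℝ (Fin 2)

/-- The objective function `J(x, y) = C₁ (x - x_d)⁴ + C₂ (y - y_d)⁴`. -/
def objective (C₁ C₂ : ℝ) (Xd X : Plane) : ℝ :=
  C₁ * (X 0 - Xd 0) ^ 4 + C₂ * (X 1 - Xd 1) ^ 4

/-- The linear velocity law (third-order dither)
`v = 2 (2π/ε)^(3/4) (3 c J sin(6πt/ε) + a cos(2πt/ε))`, where `J` is the measured value of the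
objective function. -/
def velocityLaw (c a ε t J : ℝ) : ℝ :=
  2 * (2 * Real.pi / ε) ^ (3 / 4 : ℝ) *
    (3 * c * J * Real.sin (6 * Real.pi * t / ε) + a * Real.cos (2 * Real.pi * t / ε))

/-- The right-hand side of the closed-loop unicycle system without high-pass filter:
`x' = v cos(Ωt)`, `y' = v sin(Ωt)`. -/
def unicycleField (C₁ C₂ c a Ω : ℝ) (Xd : Plane) (ε t : ℝ) (X : Plane) : Plane :=
  !₂[velocityLaw c a ε t (objective C₁ C₂ Xd X) * Real.cos (Ω * t),
     velocityLaw c a ε t (objective C₁ C₂ Xd X) * Real.sin (Ω * t)]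

/-- `X` solves `X' = f(t, X)` on `[0, T]` with `X(0) = X₀`. -/
def IsSolution (f : ℝ → Plane → Plane) (X₀ : Plane) (T : ℝ) (X : ℝ → Plane) : Prop :=
  X 0 = X₀ ∧
    ∀ t ∈ Set.Icc (0 : ℝ) T, HasDerivWithinAt X (f t (X t)) (Set.Icc (0 : ℝ) T) t

/-- The family of systems `X' = f ε t X`, `ε > 0`, is practically exponentially stable at `Xd` for
initial positions in `D`. The constants `q₁`, `q₂` do not depend on `ε`, on the initial position or
on the horizon `T`; the residual `d ε` and the threshold `ε₀` do not depend on the initial position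
or on `T`. -/
def IsPracticallyExpStable (f : ℝ → ℝ → Plane → Plane) (Xd : Plane) (D : Set Plane) : Prop :=
  ∃ q₁ > (0 : ℝ), ∃ q₂ > (0 : ℝ), ∃ d : ℝ → ℝ, Tendsto d (𝓝[>] 0) (𝓝 0) ∧
    ∃ ε₀ > (0 : ℝ), ∀ ε ∈ Set.Ioo 0 ε₀, ∀ X₀ ∈ D, ∀ T > (0 : ℝ),
      (∃ X : ℝ → Plane, IsSolution (f ε) X₀ T X) ∧
      ∀ X : ℝ → Plane, IsSolution (f ε) X₀ T X →
        ∀ t ∈ Set.Icc (0 : ℝ) T,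
          ‖X t - Xd‖ ≤ q₁ * ‖X₀ - Xd‖ * Real.exp (-(q₂ * t)) + d ε

end

/-!
With `δ = (ε / 2π)^(1/4)`, `h = (cos Ωt, sin Ωt)` and `C` the symmetric four-linear form of the
objective, `Y = X - Xd` satisfies `Y' = δ⁻³ (b'(θ) - A'(θ) C(Y, Y, Y, Y)) h`, where `b = 2a sin θ`,
`A' = -6c sin 3θ` and the phase is `θ = t / δ⁴`. Among the products `bⁱ Aʲ A'` with `i + j ≤ 3` only
`b³ A'` has a nonzero mean, `6ca³`, so the terms of orders `δ⁻³`, ..., `δ⁻¹` and the oscillation at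
order `1` are removed by a displacement `O(δ)` along `h` whose coefficients solve the homological
equations explicitly. The transformed position satisfies `W' = -24ca³ C(W, h, h, h) h + O(δ)`.

If the coefficients of the objective are `γ₁³` and `γ₂³`, then `C(w, h, h, h) = A³ + B³` with
`A = γ₁ w₀^(1/3) h₀` and `B = γ₂ w₁^(1/3) h₁`, while the gradient of the weighted `ℓ^(4/3)` gauge of
`w` pairs with `h` to a multiple of `A + B`. As `A + B` divides `A³ + B³`, the averaged flow
dissipates a multiple of `C(w, h, h, h)²`. This vanishes for some directions of `w`, but its mean
over a turn of `h` is positive definite, and adding a small periodic quadratic form to the gauge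
gives a strict Lyapunov function that is comparable to `‖w‖²`. Its decay rate does not depend on `δ`
or on the region of motion. For small `δ` the resulting estimate keeps every motion inside a ball in
which it is valid, up to any horizon.
-/

noncomputable section

open Real Set

section DifferentialInequalities

lemma le_exp_decay_of_deriv_le {f : ℝ → ℝ} {T q m : ℝ} (hq : 0 < q) (hm : 0 ≤ m)
    (hf : ∀ t ∈ Icc 0 T, ∃ D, HasDerivWithinAt f D (Icc 0 T) t ∧ D ≤ -q * f t + m)
    {t : ℝ} (ht : t ∈ Icc 0 T) : f t ≤ f 0 * exp (-(q * t)) + m / q := by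
  choose! D hD hDle using hf
  have hslope : ∀ τ ∈ Ico 0 T, ∀ r, D τ < r → ∃ᶠ z in 𝓝[>] τ, (z - τ)⁻¹ * (f z - f τ) < r :=
    fun τ hτ r hr => ((hD τ ⟨hτ.1, hτ.2.le⟩).mono_of_mem_nhdsWithin
      (Icc_mem_nhdsGE_of_mem hτ)).liminf_right_slope_le hr
  have hgronwall := le_gronwallBound_of_liminf_deriv_right_le (K := -q) (ε := m)
    (fun τ hτ => (hD τ hτ).continuousWithinAt) hslope le_rfl
    (fun τ hτ => hDle τ ⟨hτ.1, hτ.2.le⟩) t ht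
  simp only [gronwallBound_of_K_ne_0 (neg_ne_zero.2 hq.ne'), sub_zero, neg_mul] at hgronwall
  have hdrop : m / -q * (exp (-(q * t)) - 1) ≤ m / q := by
    rw [div_neg, neg_mul, neg_le, ← mul_neg_one]
    gcongr
    linarith [exp_pos (-(q * t))]
  linarith

lemma norm_le_exp_decay_of_lyapunov {E : Type*} [SeminormedAddCommGroup E] {W : ℝ → E}
    {U : ℝ → ℝ} {T m M q K η : ℝ} (hm : 0 < m) (hM : 0 ≤ M) (hq : 0 < q) (hK : 0 ≤ K) (hη : 0 ≤ η)
    (hlow : ∀ t, m * ‖W t‖ ^ 2 ≤ U t) (hup : ∀ t, U t ≤ M * ‖W t‖ ^ 2)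
    (hU : ∀ t ∈ Icc 0 T, ∃ D, HasDerivWithinAt U D (Icc 0 T) t ∧ D ≤ -q * U t + K * η ^ 2)
    {t : ℝ} (ht : t ∈ Icc 0 T) :
    ‖W t‖ ≤ √(M / m) * ‖W 0‖ * exp (-(q / 2 * t)) + √(K / (q * m)) * η := by
  have hdecay : U t ≤ U 0 * exp (-(q * t)) + K * η ^ 2 / q :=
    le_exp_decay_of_deriv_le hq (by positivity) hU ht
  have hsq : ‖W t‖ ^ 2 ≤ M / m * ‖W 0‖ ^ 2 * exp (-(q * t)) + K / (q * m) * η ^ 2 := by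
    rw [← mul_le_mul_iff_right₀ hm]
    calc m * ‖W t‖ ^ 2 ≤ M * ‖W 0‖ ^ 2 * exp (-(q * t)) + K * η ^ 2 / q := by
          refine (hlow t).trans (hdecay.trans ?_)
          gcongr
          exact hup 0
      _ = m * (M / m * ‖W 0‖ ^ 2 * exp (-(q * t)) + K / (q * m) * η ^ 2) := by field_simp
  have hexp : exp (-(q * t)) = exp (-(q / 2 * t)) ^ 2 := by
    rw [← exp_nat_mul]; congr 1; push_cast; ring
  refine le_of_sq_le_sq (hsq.trans ?_) (by positivity)
  have hcross : 0 ≤ √(M / m) * ‖W 0‖ * exp (-(q / 2 * t)) * (√(K / (q * m)) * η) := by positivity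
  calc M / m * ‖W 0‖ ^ 2 * exp (-(q * t)) + K / (q * m) * η ^ 2
      = (√(M / m) * ‖W 0‖ * exp (-(q / 2 * t))) ^ 2 + (√(K / (q * m)) * η) ^ 2 := by
        rw [hexp, mul_pow, mul_pow, mul_pow, sq_sqrt (by positivity), sq_sqrt (by positivity)]
    _ ≤ _ := by rw [add_sq]; linarith

lemma norm_le_exp_decay_of_near {E : Type*} [SeminormedAddCommGroup E] {Y W : ℝ → E}
    {p q η μ t : ℝ} (hp : 0 ≤ p) (hq : 0 ≤ q) (ht : 0 ≤ t)
    (hW : ‖W t‖ ≤ p * ‖W 0‖ * exp (-(q * t)) + η) (hnear : ∀ τ ∈ Icc 0 t, ‖W τ - Y τ‖ ≤ μ) :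
    ‖Y t‖ ≤ p * ‖Y 0‖ * exp (-(q * t)) + (p * μ + η + μ) := by
  have h0 : ‖W 0 - Y 0‖ ≤ μ := hnear 0 ⟨le_rfl, ht⟩
  have hYW : ‖Y t‖ ≤ ‖W t‖ + μ :=
    norm_le_norm_add_const_of_dist_le (by rw [dist_comm, dist_eq_norm]; exact hnear t ⟨ht, le_rfl⟩)
  have hWY : ‖W 0‖ ≤ ‖Y 0‖ + μ := norm_le_norm_add_const_of_dist_le (by rwa [dist_eq_norm])
  have hμ : 0 ≤ μ := (norm_nonneg _).trans h0
  have hdamped : p * μ * exp (-(q * t)) ≤ p * μ :=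
    mul_le_of_le_one_right (by positivity) (exp_le_one_iff.2 (neg_nonpos.2 (by positivity)))
  calc ‖Y t‖ ≤ p * (‖Y 0‖ + μ) * exp (-(q * t)) + η + μ := hYW.trans (by grw [hW, hWY])
    _ = p * ‖Y 0‖ * exp (-(q * t)) + p * μ * exp (-(q * t)) + η + μ := by ring
    _ ≤ p * ‖Y 0‖ * exp (-(q * t)) + (p * μ + η + μ) := by linarith

lemma lt_of_forall_le_imp_lt {N : ℝ → ℝ} {T R : ℝ} (hN : ContinuousOn N (Icc 0 T)) (h0 : N 0 < R)
    (hstep : ∀ t₁ ∈ Icc 0 T, (∀ t ∈ Icc 0 t₁, N t ≤ R) → N t₁ < R) :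
    ∀ t ∈ Icc 0 T, N t < R := by
  by_contra! ⟨t, ht, hRt⟩
  have exists_hit : ∀ a ∈ Icc 0 T, R ≤ N a → ∃ b ∈ Icc 0 a, N b = R := fun a ha hRa =>
    intermediate_value_Icc ha.1 (hN.mono (Icc_subset_Icc_right ha.2)) ⟨h0.le, hRa⟩
  have hcompact : IsCompact (Icc 0 T ∩ N ⁻¹' {R}) :=
    isCompact_Icc.of_isClosed_subset
      (hN.preimage_isClosed_of_isClosed isClosed_Icc isClosed_singleton) inter_subset_left
  obtain ⟨b, hb, hbR⟩ := exists_hit t ht hRt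
  obtain ⟨t₁, ⟨ht₁, hR⟩, hfirst⟩ := hcompact.exists_isLeast ⟨b, ⟨hb.1, hb.2.trans ht.2⟩, hbR⟩
  refine (hstep t₁ ht₁ fun τ hτ => ?_).ne hR
  by_contra! hlt
  have hτT : τ ∈ Icc 0 T := ⟨hτ.1, hτ.2.trans ht₁.2⟩
  obtain ⟨s, hs, hsR⟩ := exists_hit τ hτT hlt.le
  have hτt₁ : τ = t₁ := le_antisymm hτ.2 ((hfirst ⟨⟨hs.1, hs.2.trans hτT.2⟩, hsR⟩).trans hs.2)
  exact (hτt₁ ▸ hlt).ne' hR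

lemma exists_solution_of_bounded_lipschitz {E : Type*} [NormedAddCommGroup E] [NormedSpace ℝ E]
    [CompleteSpace E] {f : ℝ → E → E} {K L : NNReal} (hK : ∀ t, LipschitzWith K (f t))
    (hc : ∀ x, Continuous fun t => f t x) (hL : ∀ t x, ‖f t x‖ ≤ L) (x₀ : E) {T : ℝ}
    (hT : 0 ≤ T) :
    ∃ X : ℝ → E, X 0 = x₀ ∧ ∀ t ∈ Icc 0 T, HasDerivWithinAt X (f t (X t)) (Icc 0 T) t := by
  have : IsPicardLindelof f (⟨0, le_rfl, hT⟩ : Icc 0 T) x₀ (L * T.toNNReal) 0 L K :=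
    { lipschitzOnWith := fun t _ => (hK t).lipschitzOnWith
      continuousOn := fun x _ => (hc x).continuousOn
      norm_le := fun t _ x _ => hL t x
      mul_max_le := by simp [hT] }
  exact this.exists_eq_forall_mem_Icc_hasDerivWithinAt₀

lemma exists_bounded_lipschitz_eqOn_closedBall {E : Type*} [NormedAddCommGroup E]
    [NormedSpace ℝ E] [FiniteDimensional ℝ E] {J : E → ℝ} (hJ : ContDiff ℝ 1 J) (x₀ : E) (R : ℝ) :
    ∃ g : E → ℝ, ∃ K B : NNReal, LipschitzWith K g ∧ (∀ x, ‖g x‖ ≤ B) ∧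
      EqOn g J (Metric.closedBall x₀ R) := by
  let χ : ContDiffBump x₀ := ⟨|R| + 1, |R| + 2, by positivity, by linarith⟩
  have hg : ContDiff ℝ 1 fun x => χ x * J x := χ.contDiff.mul hJ
  have hsupp : HasCompactSupport fun x => χ x * J x := χ.hasCompactSupport.mul_right
  obtain ⟨K, hK⟩ := hg.lipschitzWith_of_hasCompactSupport hsupp one_ne_zero
  obtain ⟨B, hB⟩ := hsupp.exists_bound_of_continuous hg.continuous
  refine ⟨_, K, B.toNNReal, hK, fun x => (hB x).trans (le_coe_toNNReal B), fun x hx => ?_⟩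
  have hχ : χ x = 1 :=
    χ.one_of_mem_closedBall (Metric.closedBall_subset_closedBall (by
      change R ≤ |R| + 1
      linarith [le_abs_self R]) hx)
  simp only [hχ, one_mul]

end DifferentialInequalities

section Plane

lemma hasDerivWithinAt_euclidean {n : ℕ} {X : ℝ → EuclideanSpace ℝ (Fin n)}
    {X' : EuclideanSpace ℝ (Fin n)} {s : Set ℝ} {t : ℝ} :
    HasDerivWithinAt X X' s t ↔ ∀ i, HasDerivWithinAt (fun τ => X τ i) (X' i) s t := by
  simp only [hasDerivWithinAt_iff_hasFDerivWithinAt]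
  exact hasFDerivWithinAt_euclidean

lemma norm_sq_plane (X : Plane) : ‖X‖ ^ 2 = X 0 ^ 2 + X 1 ^ 2 := by
  rw [EuclideanSpace.real_norm_sq_eq, Fin.sum_univ_two]

lemma abs_apply_le_norm (X : Plane) (i : Fin 2) : |X i| ≤ ‖X‖ := PiLp.norm_apply_le X i

/-- The unit vector with polar angle `θ`. -/
def heading (θ : ℝ) : Plane := !₂[cos θ, sin θ]

lemma norm_heading (θ : ℝ) : ‖heading θ‖ = 1 := by
  rw [EuclideanSpace.norm_eq, heading]
  simp

lemma hasDerivWithinAt_heading (Ω : ℝ) (s : Set ℝ) (t : ℝ) :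
    HasDerivWithinAt (fun τ => heading (Ω * τ)) (Ω • heading (Ω * t + π / 2)) s t := by
  have hangle : HasDerivWithinAt (fun τ => Ω * τ) Ω s t := by
    simpa using (hasDerivWithinAt_id t s).const_mul Ω
  refine hasDerivWithinAt_euclidean.2 fun i => ?_
  fin_cases i
  · exact hangle.cos.congr_deriv (by simp [heading, cos_add_pi_div_two, mul_comm])
  · exact hangle.sin.congr_deriv (by simp [heading, sin_add_pi_div_two, mul_comm])

lemma hasDerivWithinAt_heading_apply_zero (Ω : ℝ) (s : Set ℝ) (t : ℝ) :
    HasDerivWithinAt (fun τ => heading (Ω * τ) 0) (-(Ω * heading (Ω * t) 1)) s t :=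
  (hasDerivWithinAt_euclidean.1 (hasDerivWithinAt_heading Ω s t) 0).congr_deriv
    (by simp [heading, cos_add_pi_div_two])

lemma hasDerivWithinAt_heading_apply_one (Ω : ℝ) (s : Set ℝ) (t : ℝ) :
    HasDerivWithinAt (fun τ => heading (Ω * τ) 1) (Ω * heading (Ω * t) 0) s t :=
  (hasDerivWithinAt_euclidean.1 (hasDerivWithinAt_heading Ω s t) 1).congr_deriv
    (by simp [heading, sin_add_pi_div_two])

lemma continuous_heading : Continuous heading := by
  unfold heading
  fun_prop

/-- The symmetric four-linear form whose diagonal is `C₁ x⁴ + C₂ y⁴`. -/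
def quarticForm (C₁ C₂ : ℝ) (p q r s : Plane) : ℝ :=
  C₁ * (p 0 * q 0 * r 0 * s 0) + C₂ * (p 1 * q 1 * r 1 * s 1)

lemma hasDerivWithinAt_quarticForm {C₁ C₂ t : ℝ} {S : Set ℝ} {p q r s : ℝ → Plane}
    {p' q' r' s' : Plane} (hp : HasDerivWithinAt p p' S t) (hq : HasDerivWithinAt q q' S t)
    (hr : HasDerivWithinAt r r' S t) (hs : HasDerivWithinAt s s' S t) :
    HasDerivWithinAt (fun τ => quarticForm C₁ C₂ (p τ) (q τ) (r τ) (s τ))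
      (quarticForm C₁ C₂ p' (q t) (r t) (s t) + quarticForm C₁ C₂ (p t) q' (r t) (s t)
        + quarticForm C₁ C₂ (p t) (q t) r' (s t) + quarticForm C₁ C₂ (p t) (q t) (r t) s') S t := by
  rw [hasDerivWithinAt_euclidean] at hp hq hr hs
  have hprod (i : Fin 2) := (((hp i).fun_mul (hq i)).fun_mul (hr i)).fun_mul (hs i)
  refine (((hprod 0).const_mul C₁).fun_add ((hprod 1).const_mul C₂)).congr_deriv ?_
  simp only [quarticForm]
  ring

lemma objective_eq_quarticForm (C₁ C₂ : ℝ) (Xd X : Plane) :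
    objective C₁ C₂ Xd X = quarticForm C₁ C₂ (X - Xd) (X - Xd) (X - Xd) (X - Xd) := by
  simp only [objective, quarticForm, PiLp.sub_apply]
  ring

lemma unicycleField_eq_smul_heading (C₁ C₂ c a Ω : ℝ) (Xd : Plane) (ε t : ℝ) (X : Plane) :
    unicycleField C₁ C₂ c a Ω Xd ε t X =
      velocityLaw c a ε t (objective C₁ C₂ Xd X) • heading (Ω * t) := by
  ext i
  fin_cases i <;> simp [unicycleField, heading]

end Plane

section DualGauge

/-- The real cube root. It makes `C₁ x₀ h₀³ + C₂ x₁ h₁³` a sum of two cubes, hence divisible by the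
sum of their bases. -/
def cbrt (x : ℝ) : ℝ := |x| ^ (-(2 / 3) : ℝ) * x

lemma cbrt_pow_three (x : ℝ) : cbrt x ^ 3 = x := by
  rcases eq_or_ne x 0 with rfl | hx
  · simp [cbrt]
  have hpow : (|x| ^ (-(2 / 3) : ℝ)) ^ 3 * x ^ 2 = 1 := by
    rw [← rpow_mul_natCast (abs_nonneg x), ← sq_abs, ← rpow_natCast |x| 2,
      ← rpow_add (abs_pos.2 hx)]
    norm_num
  linear_combination x * hpow + congrArg (· ^ 3) (cbrt.eq_1 x)

lemma cbrt_pow_four (x : ℝ) : cbrt x ^ 4 = |x| ^ (4 / 3 : ℝ) := by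
  rcases eq_or_ne x 0 with rfl | hx
  · simp [cbrt]
  rw [cbrt, mul_pow, ← rpow_mul_natCast (abs_nonneg x), ← Even.pow_abs (by decide) x,
    ← rpow_natCast |x| 4, ← rpow_add (abs_pos.2 hx)]
  norm_num

lemma hasDerivAt_cbrt_pow_four (x : ℝ) : HasDerivAt (fun y => cbrt y ^ 4) (4 / 3 * cbrt x) x := by
  simp only [cbrt_pow_four]
  refine (hasDerivAt_abs_rpow x (p := 4 / 3) (by norm_num)).congr_deriv ?_
  rw [cbrt, mul_assoc]
  norm_num

variable {γ₁ γ₂ : ℝ}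

/-- `γ₁ |w₀|^(4/3) + γ₂ |w₁|^(4/3)`, the weighted `ℓ^(4/3)` gauge to the power `4/3`. The
exponent is conjugate to the exponent `4` of the objective. -/
def cbrtQuartic (γ₁ γ₂ : ℝ) (w : Plane) : ℝ := γ₁ * cbrt (w 0) ^ 4 + γ₂ * cbrt (w 1) ^ 4

/-- The Lyapunov function of the averaged system: a quadratically homogeneous power of the weighted
`ℓ^(4/3)` gauge. Its gradient pairs with a direction `h` to a multiple of `A + B`, where `A ^ 3` and
`B ^ 3` are the two terms of the quartic form at `(w, h, h, h)`. -/
def dualGauge (γ₁ γ₂ : ℝ) (w : Plane) : ℝ := cbrtQuartic γ₁ γ₂ w ^ (3 / 2 : ℝ)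

/-- The gradient of `dualGauge`. -/
def dualGaugeGrad (γ₁ γ₂ : ℝ) (w : Plane) : Plane :=
  (2 * √(cbrtQuartic γ₁ γ₂ w)) • !₂[γ₁ * cbrt (w 0), γ₂ * cbrt (w 1)]

lemma inner_dualGaugeGrad (w v : Plane) :
    inner ℝ (dualGaugeGrad γ₁ γ₂ w) v =
      2 * √(cbrtQuartic γ₁ γ₂ w) * (γ₁ * cbrt (w 0) * v 0 + γ₂ * cbrt (w 1) * v 1) := by
  simp only [dualGaugeGrad, PiLp.inner_apply, Fin.sum_univ_two, PiLp.smul_apply, smul_eq_mul,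
    RCLike.inner_apply, conj_trivial, Matrix.cons_val_zero, Matrix.cons_val_one]
  ring

lemma hasDerivWithinAt_dualGauge {W : ℝ → Plane} {W' : Plane} {s : Set ℝ} {t : ℝ}
    (hW : HasDerivWithinAt W W' s t) :
    HasDerivWithinAt (fun τ => dualGauge γ₁ γ₂ (W τ)) (inner ℝ (dualGaugeGrad γ₁ γ₂ (W t)) W')
      s t := by
  have hcoord := hasDerivWithinAt_euclidean.1 hW
  have hquartic : HasDerivWithinAt (fun τ => cbrtQuartic γ₁ γ₂ (W τ))
      (γ₁ * (4 / 3 * cbrt (W t 0) * W' 0) + γ₂ * (4 / 3 * cbrt (W t 1) * W' 1)) s t :=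
    (((hasDerivAt_cbrt_pow_four _).comp_hasDerivWithinAt t (hcoord 0)).const_mul γ₁).add
      (((hasDerivAt_cbrt_pow_four _).comp_hasDerivWithinAt t (hcoord 1)).const_mul γ₂)
  refine (hquartic.rpow_const (Or.inr (by norm_num : (1 : ℝ) ≤ 3 / 2))).congr_deriv ?_
  rw [inner_dualGaugeGrad, sqrt_eq_rpow]
  norm_num
  ring

/-- The squared Euclidean norm of the coordinatewise cube root, a gauge homogeneous of degree
`2/3` through which the dual gauge, its gradient and the Euclidean norm are compared. -/
def cbrtNormSq (w : Plane) : ℝ := cbrt (w 0) ^ 2 + cbrt (w 1) ^ 2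

lemma cbrtNormSq_nonneg (w : Plane) : 0 ≤ cbrtNormSq w := by
  unfold cbrtNormSq
  positivity

lemma norm_sq_eq_cbrt (w : Plane) : ‖w‖ ^ 2 = cbrt (w 0) ^ 6 + cbrt (w 1) ^ 6 := by
  rw [norm_sq_plane]
  nth_rewrite 1 [← cbrt_pow_three (w 0), ← cbrt_pow_three (w 1)]
  ring

lemma norm_sq_le_cbrtNormSq_pow_three (w : Plane) : ‖w‖ ^ 2 ≤ cbrtNormSq w ^ 3 := by
  rw [norm_sq_eq_cbrt, cbrtNormSq]
  have h : 0 ≤ 3 * cbrt (w 0) ^ 2 * cbrt (w 1) ^ 2 * (cbrt (w 0) ^ 2 + cbrt (w 1) ^ 2) := by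
    positivity
  linarith

lemma cbrtNormSq_pow_three_le (w : Plane) : cbrtNormSq w ^ 3 ≤ 4 * ‖w‖ ^ 2 := by
  rw [norm_sq_eq_cbrt, cbrtNormSq]
  have h := add_pow_le (sq_nonneg (cbrt (w 0))) (sq_nonneg (cbrt (w 1))) 3
  norm_num at h
  linarith

lemma mul_cbrtNormSq_le_sqrt_cbrtQuartic {γ : ℝ} (hγ : 0 ≤ γ) (h₁ : γ ≤ γ₁) (h₂ : γ ≤ γ₂)
    (w : Plane) : √(γ / 2) * cbrtNormSq w ≤ √(cbrtQuartic γ₁ γ₂ w) := by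
  refine le_sqrt_of_sq_le ?_
  rw [mul_pow, sq_sqrt (by positivity)]
  calc γ / 2 * cbrtNormSq w ^ 2
      ≤ γ / 2 * (2 * ((cbrt (w 0) ^ 2) ^ 2 + (cbrt (w 1) ^ 2) ^ 2)) := by
        gcongr
        exact add_sq_le
    _ = γ * cbrt (w 0) ^ 4 + γ * cbrt (w 1) ^ 4 := by ring
    _ ≤ cbrtQuartic γ₁ γ₂ w := by unfold cbrtQuartic; gcongr

lemma cbrtQuartic_le (h₁ : 0 ≤ γ₁) (h₂ : 0 ≤ γ₂) (w : Plane) :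
    cbrtQuartic γ₁ γ₂ w ≤ (γ₁ + γ₂) * cbrtNormSq w ^ 2 := by
  have h : 0 ≤ γ₁ * (2 * cbrt (w 0) ^ 2 * cbrt (w 1) ^ 2 + cbrt (w 1) ^ 4)
      + γ₂ * (2 * cbrt (w 0) ^ 2 * cbrt (w 1) ^ 2 + cbrt (w 0) ^ 4) := by positivity
  unfold cbrtQuartic cbrtNormSq
  linarith

lemma sqrt_cbrtQuartic_le (h₁ : 0 ≤ γ₁) (h₂ : 0 ≤ γ₂) (w : Plane) :
    √(cbrtQuartic γ₁ γ₂ w) ≤ √(γ₁ + γ₂) * cbrtNormSq w := by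
  refine (sqrt_le_sqrt (cbrtQuartic_le h₁ h₂ w)).trans_eq ?_
  rw [sqrt_mul (by positivity), sqrt_sq (cbrtNormSq_nonneg w)]

lemma dualGauge_eq_sqrt_pow_three (h₁ : 0 ≤ γ₁) (h₂ : 0 ≤ γ₂) (w : Plane) :
    dualGauge γ₁ γ₂ w = √(cbrtQuartic γ₁ γ₂ w) ^ 3 := by
  have hnonneg : 0 ≤ cbrtQuartic γ₁ γ₂ w := by unfold cbrtQuartic; positivity
  rw [dualGauge, sqrt_eq_rpow, ← rpow_mul_natCast hnonneg]
  norm_num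

lemma mul_norm_sq_le_dualGauge {γ : ℝ} (hγ : 0 ≤ γ) (h₁ : γ ≤ γ₁) (h₂ : γ ≤ γ₂) (w : Plane) :
    √(γ / 2) ^ 3 * ‖w‖ ^ 2 ≤ dualGauge γ₁ γ₂ w := by
  rw [dualGauge_eq_sqrt_pow_three (hγ.trans h₁) (hγ.trans h₂)]
  calc √(γ / 2) ^ 3 * ‖w‖ ^ 2 ≤ √(γ / 2) ^ 3 * cbrtNormSq w ^ 3 := by
        gcongr
        exact norm_sq_le_cbrtNormSq_pow_three w
    _ = (√(γ / 2) * cbrtNormSq w) ^ 3 := by ring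
    _ ≤ _ := pow_le_pow_left₀ (mul_nonneg (sqrt_nonneg _) (cbrtNormSq_nonneg w))
        (mul_cbrtNormSq_le_sqrt_cbrtQuartic hγ h₁ h₂ w) 3

lemma dualGauge_le (h₁ : 0 ≤ γ₁) (h₂ : 0 ≤ γ₂) (w : Plane) :
    dualGauge γ₁ γ₂ w ≤ 4 * √(γ₁ + γ₂) ^ 3 * ‖w‖ ^ 2 := by
  rw [dualGauge_eq_sqrt_pow_three h₁ h₂]
  calc √(cbrtQuartic γ₁ γ₂ w) ^ 3 ≤ (√(γ₁ + γ₂) * cbrtNormSq w) ^ 3 := by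
        gcongr
        exact sqrt_cbrtQuartic_le h₁ h₂ w
    _ = √(γ₁ + γ₂) ^ 3 * cbrtNormSq w ^ 3 := by ring
    _ ≤ √(γ₁ + γ₂) ^ 3 * (4 * ‖w‖ ^ 2) := by
        gcongr
        exact cbrtNormSq_pow_three_le w
    _ = _ := by ring

lemma weighted_cbrt_sq_add_sq_le (h₁ : 0 ≤ γ₁) (h₂ : 0 ≤ γ₂) (w : Plane) :
    (γ₁ * cbrt (w 0)) ^ 2 + (γ₂ * cbrt (w 1)) ^ 2 ≤ (γ₁ + γ₂) ^ 2 * cbrtNormSq w := by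
  have h : 0 ≤ (2 * γ₁ * γ₂ + γ₂ ^ 2) * cbrt (w 0) ^ 2
      + (γ₁ ^ 2 + 2 * γ₁ * γ₂) * cbrt (w 1) ^ 2 := by positivity
  unfold cbrtNormSq
  linarith

lemma norm_dualGaugeGrad_le (h₁ : 0 ≤ γ₁) (h₂ : 0 ≤ γ₂) (w : Plane) :
    ‖dualGaugeGrad γ₁ γ₂ w‖ ≤ 4 * √(γ₁ + γ₂) ^ 3 * ‖w‖ := by
  have hsqrt : √(γ₁ + γ₂) ^ 2 = γ₁ + γ₂ := sq_sqrt (by positivity)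
  have := cbrtNormSq_nonneg w
  refine le_of_sq_le_sq ?_ (by positivity)
  calc ‖dualGaugeGrad γ₁ γ₂ w‖ ^ 2
      = 4 * √(cbrtQuartic γ₁ γ₂ w) ^ 2 * ((γ₁ * cbrt (w 0)) ^ 2 + (γ₂ * cbrt (w 1)) ^ 2) := by
        rw [norm_sq_plane]
        simp only [dualGaugeGrad, PiLp.smul_apply, smul_eq_mul, Matrix.cons_val_zero,
          Matrix.cons_val_one]
        ring
    _ ≤ 4 * (√(γ₁ + γ₂) * cbrtNormSq w) ^ 2 * ((γ₁ + γ₂) ^ 2 * cbrtNormSq w) := by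
        gcongr
        · exact sqrt_cbrtQuartic_le h₁ h₂ w
        · exact weighted_cbrt_sq_add_sq_le h₁ h₂ w
    _ = 4 * (γ₁ + γ₂) ^ 3 * cbrtNormSq w ^ 3 := by rw [mul_pow, hsqrt]; ring
    _ ≤ 4 * (γ₁ + γ₂) ^ 3 * (4 * ‖w‖ ^ 2) := by
        gcongr
        exact cbrtNormSq_pow_three_le w
    _ = 16 * (√(γ₁ + γ₂) ^ 2) ^ 3 * ‖w‖ ^ 2 := by rw [hsqrt]; ring
    _ = (4 * √(γ₁ + γ₂) ^ 3 * ‖w‖) ^ 2 := by ring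

lemma le_inner_dualGaugeGrad_mul {γ : ℝ} (hγ : 0 < γ) (h₁ : γ ≤ γ₁) (h₂ : γ ≤ γ₂) (w : Plane)
    {h : Plane} (hh : ‖h‖ ≤ 1) :
    4 * √(γ / 2) / (3 * (γ₁ + γ₂) ^ 2) * quarticForm (γ₁ ^ 3) (γ₂ ^ 3) w h h h ^ 2
      ≤ inner ℝ (dualGaugeGrad γ₁ γ₂ w) h * quarticForm (γ₁ ^ 3) (γ₂ ^ 3) w h h h := by
  set A := γ₁ * cbrt (w 0) * h 0 with hA
  set B := γ₂ * cbrt (w 1) * h 1 with hB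
  have hΓ : 0 < γ₁ + γ₂ := by linarith
  have hfactor : quarticForm (γ₁ ^ 3) (γ₂ ^ 3) w h h h = (A + B) * (A ^ 2 - A * B + B ^ 2) := by
    rw [quarticForm, ← cbrt_pow_three (w 0), ← cbrt_pow_three (w 1), hA, hB]
    ring
  have hcofactor : 2 * √(γ / 2) / (3 * (γ₁ + γ₂) ^ 2) * (A ^ 2 - A * B + B ^ 2)
      ≤ √(cbrtQuartic γ₁ γ₂ w) := by
    have hA' : A ^ 2 ≤ (γ₁ * cbrt (w 0)) ^ 2 := by
      rw [hA, mul_pow _ (h 0)]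
      exact mul_le_of_le_one_right (sq_nonneg _) (by nlinarith [norm_sq_plane h, norm_nonneg h])
    have hB' : B ^ 2 ≤ (γ₂ * cbrt (w 1)) ^ 2 := by
      rw [hB, mul_pow _ (h 1)]
      exact mul_le_of_le_one_right (sq_nonneg _) (by nlinarith [norm_sq_plane h, norm_nonneg h])
    have hsq : A ^ 2 - A * B + B ^ 2 ≤ 3 / 2 * ((γ₁ + γ₂) ^ 2 * cbrtNormSq w) := by
      linarith [weighted_cbrt_sq_add_sq_le (hγ.le.trans h₁) (hγ.le.trans h₂) w, sq_nonneg (A + B)]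
    calc 2 * √(γ / 2) / (3 * (γ₁ + γ₂) ^ 2) * (A ^ 2 - A * B + B ^ 2)
        ≤ 2 * √(γ / 2) / (3 * (γ₁ + γ₂) ^ 2) * (3 / 2 * ((γ₁ + γ₂) ^ 2 * cbrtNormSq w)) := by
          gcongr
      _ = √(γ / 2) * cbrtNormSq w := by field_simp
      _ ≤ _ := mul_cbrtNormSq_le_sqrt_cbrtQuartic hγ.le h₁ h₂ w
  rw [inner_dualGaugeGrad, ← hA, ← hB, hfactor]
  have hnonneg : 0 ≤ 2 * (A + B) ^ 2 * (A ^ 2 - A * B + B ^ 2) := by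
    nlinarith [sq_nonneg (A - B), sq_nonneg (A + B), sq_nonneg A, sq_nonneg B]
  linear_combination
    (2 * (A + B) ^ 2 * (A ^ 2 - A * B + B ^ 2)) * hcofactor

end DualGauge

section Lyapunov

variable {C₁ C₂ Ω : ℝ}

/-- A primitive along the circle `(cos θ, sin θ)` of `cos⁶ θ - 5/16`, where `5/16` is the mean of
`cos⁶`. -/
def cosSixPrimitive (c s : ℝ) : ℝ := s * c * (c ^ 4 / 6 + 5 * c ^ 2 / 24 + 5 / 16)

/-- A primitive along the circle `(cos θ, sin θ)` of `cos³ θ sin³ θ`, whose mean is zero. -/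
def sinCosCubePrimitive (s : ℝ) : ℝ := s ^ 4 / 4 - s ^ 6 / 6

/-- The bilinear form in `v`, `w` whose derivative along a rotating unit vector `h` is the deviation
of `(quarticForm C₁ C₂ w h h h) ^ 2` from its mean over the circle. Added to the Lyapunov function
with a small weight it turns dissipation in the direction of the heading only into dissipation in
all directions. -/
def excitationForm (C₁ C₂ : ℝ) (h v w : Plane) : ℝ :=
  C₁ ^ 2 * cosSixPrimitive (h 0) (h 1) * (v 0 * w 0)
    + C₁ * C₂ * sinCosCubePrimitive (h 1) * (v 0 * w 1 + v 1 * w 0)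
    - C₂ ^ 2 * cosSixPrimitive (h 1) (h 0) * (v 1 * w 1)

lemma hasDerivAt_cosSixPrimitive (θ : ℝ) :
    HasDerivAt (fun θ => cosSixPrimitive (cos θ) (sin θ)) (cos θ ^ 6 - 5 / 16) θ := by
  have hpoly := ((((hasDerivAt_cos θ).pow 4).div_const 6).add
    ((((hasDerivAt_cos θ).pow 2).const_mul 5).div_const 24)).add_const (5 / 16)
  refine (((hasDerivAt_sin θ).mul (hasDerivAt_cos θ)).mul hpoly).congr_deriv ?_
  simp only [Pi.add_apply, Pi.mul_apply, Pi.pow_apply]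
  push_cast
  linear_combination -(5 / 6 * cos θ ^ 4 + 5 / 8 * cos θ ^ 2 + 5 / 16) * sin_sq θ

lemma hasDerivAt_cosSixPrimitive_swap (θ : ℝ) :
    HasDerivAt (fun θ => cosSixPrimitive (sin θ) (cos θ)) (-(sin θ ^ 6 - 5 / 16)) θ := by
  have hcomp :=
    (hasDerivAt_cosSixPrimitive (π / 2 - θ)).comp θ ((hasDerivAt_id θ).const_sub (π / 2))
  simpa [Function.comp_def, cos_pi_div_two_sub, sin_pi_div_two_sub] using hcomp

lemma hasDerivAt_sinCosCubePrimitive (θ : ℝ) :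
    HasDerivAt (fun θ => sinCosCubePrimitive (sin θ)) (cos θ ^ 3 * sin θ ^ 3) θ := by
  refine ((((hasDerivAt_sin θ).pow 4).div_const 4).sub
    (((hasDerivAt_sin θ).pow 6).div_const 6)).congr_deriv ?_
  linear_combination -(sin θ ^ 3 * cos θ) * cos_sq' θ

lemma hasDerivWithinAt_excitationForm {W : ℝ → Plane} {W' : Plane} {s : Set ℝ} {t : ℝ}
    (hW : HasDerivWithinAt W W' s t) :
    HasDerivWithinAt (fun τ => excitationForm C₁ C₂ (heading (Ω * τ)) (W τ) (W τ))
      (Ω * (quarticForm C₁ C₂ (W t) (heading (Ω * t)) (heading (Ω * t)) (heading (Ω * t)) ^ 2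
          - 5 / 16 * ((C₁ * W t 0) ^ 2 + (C₂ * W t 1) ^ 2))
        + 2 * excitationForm C₁ C₂ (heading (Ω * t)) (W t) W') s t := by
  have hangle : HasDerivWithinAt (fun τ => Ω * τ) Ω s t := by
    simpa using (hasDerivWithinAt_id t s).const_mul Ω
  have hF := (hasDerivAt_cosSixPrimitive (Ω * t)).comp_hasDerivWithinAt t hangle
  have hF' := (hasDerivAt_cosSixPrimitive_swap (Ω * t)).comp_hasDerivWithinAt t hangle
  have hG := (hasDerivAt_sinCosCubePrimitive (Ω * t)).comp_hasDerivWithinAt t hangle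
  have hW₀ := hasDerivWithinAt_euclidean.1 hW 0
  have hW₁ := hasDerivWithinAt_euclidean.1 hW 1
  refine ((((hF.const_mul (C₁ ^ 2)).fun_mul (hW₀.fun_mul hW₀)).fun_add
    ((hG.const_mul (C₁ * C₂)).fun_mul ((hW₀.fun_mul hW₁).fun_add (hW₁.fun_mul hW₀)))).fun_sub
    ((hF'.const_mul (C₂ ^ 2)).fun_mul (hW₁.fun_mul hW₁))).congr_deriv ?_
  simp only [excitationForm, quarticForm, heading, Matrix.cons_val_zero, Matrix.cons_val_one,
    Function.comp_apply]
  ring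

lemma abs_cosSixPrimitive_le {c s : ℝ} (hc : |c| ≤ 1) (hs : |s| ≤ 1) :
    |cosSixPrimitive c s| ≤ 1 := by
  have hc2 : c ^ 2 ≤ 1 := (sq_le_one_iff_abs_le_one c).2 hc
  have hpoly : c ^ 4 / 6 + 5 * c ^ 2 / 24 + 5 / 16 ≤ 1 := by nlinarith [sq_nonneg c]
  rw [cosSixPrimitive, abs_mul, abs_mul, abs_of_nonneg (by positivity : 0 ≤ c ^ 4 / 6 + _ + _)]
  exact mul_le_one₀ (mul_le_one₀ hs (abs_nonneg c) hc) (by positivity) hpoly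

lemma abs_sinCosCubePrimitive_le {s : ℝ} (hs : |s| ≤ 1) : |sinCosCubePrimitive s| ≤ 1 := by
  have hs2 : s ^ 2 ≤ 1 := (sq_le_one_iff_abs_le_one s).2 hs
  rw [sinCosCubePrimitive, abs_le]
  constructor <;> nlinarith [sq_nonneg s, pow_nonneg (sq_nonneg s) 2, pow_nonneg (sq_nonneg s) 3]

lemma abs_excitationForm_le {h : Plane} (hh : ‖h‖ ≤ 1) (v w : Plane) :
    |excitationForm C₁ C₂ h v w| ≤ (|C₁| + |C₂|) ^ 2 * (‖v‖ * ‖w‖) := by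
  have hcoord (i : Fin 2) : |h i| ≤ 1 := (abs_apply_le_norm h i).trans hh
  have hF₁ := abs_cosSixPrimitive_le (hcoord 0) (hcoord 1)
  have hF₂ := abs_cosSixPrimitive_le (hcoord 1) (hcoord 0)
  have hG := abs_sinCosCubePrimitive_le (hcoord 1)
  have hcross : |v 0 * w 1 + v 1 * w 0| ≤ ‖v‖ * ‖w‖ + ‖v‖ * ‖w‖ := by
    refine (abs_add_le _ _).trans ?_
    rw [abs_mul, abs_mul]
    gcongr <;> exact abs_apply_le_norm _ _
  calc |excitationForm C₁ C₂ h v w|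
      ≤ |C₁ ^ 2 * cosSixPrimitive (h 0) (h 1) * (v 0 * w 0)|
        + |C₁ * C₂ * sinCosCubePrimitive (h 1) * (v 0 * w 1 + v 1 * w 0)|
        + |C₂ ^ 2 * cosSixPrimitive (h 1) (h 0) * (v 1 * w 1)| :=
        (abs_sub _ _).trans (add_le_add_left (abs_add_le _ _) _)
    _ ≤ |C₁| ^ 2 * 1 * (‖v‖ * ‖w‖) + |C₁| * |C₂| * 1 * (‖v‖ * ‖w‖ + ‖v‖ * ‖w‖)
        + |C₂| ^ 2 * 1 * (‖v‖ * ‖w‖) := by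
        simp only [abs_mul, abs_pow]
        gcongr <;> exact abs_apply_le_norm _ _
    _ = (|C₁| + |C₂|) ^ 2 * (‖v‖ * ‖w‖) := by ring

lemma inner_dualGaugeGrad_averaged_le {γ γ₁ γ₂ k : ℝ} (hγ : 0 < γ) (h₁ : γ ≤ γ₁) (h₂ : γ ≤ γ₂)
    (hk : 0 ≤ k) {h : Plane} (hh : ‖h‖ ≤ 1) (w e : Plane) :
    inner ℝ (dualGaugeGrad γ₁ γ₂ w) (-(k * quarticForm (γ₁ ^ 3) (γ₂ ^ 3) w h h h) • h + e)
      ≤ -(k * (4 * √(γ / 2) / (3 * (γ₁ + γ₂) ^ 2))) *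
            quarticForm (γ₁ ^ 3) (γ₂ ^ 3) w h h h ^ 2
        + 4 * √(γ₁ + γ₂) ^ 3 * ‖w‖ * ‖e‖ := by
  have hdiss := mul_le_mul_of_nonneg_left (le_inner_dualGaugeGrad_mul hγ h₁ h₂ w hh) hk
  have herror : inner ℝ (dualGaugeGrad γ₁ γ₂ w) e ≤ 4 * √(γ₁ + γ₂) ^ 3 * ‖w‖ * ‖e‖ := by
    refine (real_inner_le_norm _ _).trans ?_
    gcongr
    exact norm_dualGaugeGrad_le (hγ.le.trans h₁) (hγ.le.trans h₂) w
  rw [inner_add_right, inner_smul_right]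
  linarith

lemma excitation_averaged_le {C₀ : ℝ} (k : ℝ) (hΩ : Ω ≠ 0) (hC₀ : 0 ≤ C₀) (h₁ : C₀ ≤ C₁)
    (h₂ : C₀ ≤ C₂) {h : Plane} (hh : ‖h‖ ≤ 1) (w e : Plane) :
    Ω⁻¹ * (Ω * (quarticForm C₁ C₂ w h h h ^ 2 - 5 / 16 * ((C₁ * w 0) ^ 2 + (C₂ * w 1) ^ 2))
        + 2 * excitationForm C₁ C₂ h w (-(k * quarticForm C₁ C₂ w h h h) • h + e))
      ≤ quarticForm C₁ C₂ w h h h ^ 2 - 5 / 16 * C₀ ^ 2 * ‖w‖ ^ 2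
        + 2 * |Ω⁻¹| * (|C₁| + |C₂|) ^ 2 * (|k| + 1) * ‖w‖ *
            (|quarticForm C₁ C₂ w h h h| + ‖e‖) := by
  set ℓ := quarticForm C₁ C₂ w h h h
  have hspeed : ‖-(k * ℓ) • h + e‖ ≤ (|k| + 1) * (|ℓ| + ‖e‖) := by
    calc ‖-(k * ℓ) • h + e‖ ≤ |k| * |ℓ| * ‖h‖ + ‖e‖ := by
          refine (norm_add_le _ _).trans_eq ?_
          rw [norm_smul, norm_neg, norm_mul, Real.norm_eq_abs, Real.norm_eq_abs]
      _ ≤ |k| * |ℓ| * 1 + ‖e‖ := by gcongr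
      _ ≤ (|k| + 1) * (|ℓ| + ‖e‖) := by
          have : 0 ≤ |k| * ‖e‖ + |ℓ| := by positivity
          linarith
  have hcross : Ω⁻¹ * (2 * excitationForm C₁ C₂ h w (-(k * ℓ) • h + e))
      ≤ |Ω⁻¹| * (2 * ((|C₁| + |C₂|) ^ 2 * (‖w‖ * ((|k| + 1) * (|ℓ| + ‖e‖))))) := by
    refine (le_abs_self _).trans ?_
    rw [abs_mul, abs_mul, abs_two]
    gcongr
    exact (abs_excitationForm_le hh _ _).trans (by gcongr)
  have hmean : C₀ ^ 2 * ‖w‖ ^ 2 ≤ (C₁ * w 0) ^ 2 + (C₂ * w 1) ^ 2 := by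
    rw [norm_sq_plane, mul_pow, mul_pow, mul_add]
    gcongr
  rw [mul_add, inv_mul_cancel_left₀ hΩ]
  linarith

lemma exists_dissipation_weight {a ν μ₀ : ℝ} (K₁ K₂ : ℝ) (ha : 0 < a) (hν : 0 < ν)
    (hμ₀ : 0 < μ₀) :
    ∃ μ > 0, μ ≤ μ₀ ∧ ∃ L ≥ 0, ∀ n ℓ η : ℝ,
      -a * ℓ ^ 2 + K₁ * n * η + μ * (ℓ ^ 2 - ν * n ^ 2 + K₂ * n * (|ℓ| + η))
        ≤ -(μ * ν / 2) * n ^ 2 + L * η ^ 2 := by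
  refine ⟨min μ₀ (a / (1 + K₂ ^ 2 / ν)), by positivity, min_le_left _ _, ?_⟩
  set μ := min μ₀ (a / (1 + K₂ ^ 2 / ν))
  have hμ : 0 < μ := by positivity
  have hμa : μ * (1 + K₂ ^ 2 / ν) ≤ a := (le_div_iff₀ (by positivity)).1 (min_le_right _ _)
  refine ⟨(K₁ + μ * K₂) ^ 2 / (μ * ν), by positivity, fun n ℓ η => ?_⟩
  have hℓ : K₂ * n * |ℓ| ≤ ν / 4 * n ^ 2 + K₂ ^ 2 / ν * ℓ ^ 2 := by
    have h := two_mul_le_add_mul_sq (a := n) (b := K₂ * |ℓ|) (half_pos hν)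
    rw [mul_pow, sq_abs, inv_div] at h
    linear_combination h / 2
  have hη : (K₁ + μ * K₂) * n * η
      ≤ μ * ν / 4 * n ^ 2 + (K₁ + μ * K₂) ^ 2 / (μ * ν) * η ^ 2 := by
    have h := two_mul_le_add_mul_sq (a := n) (b := (K₁ + μ * K₂) * η) (half_pos (mul_pos hμ hν))
    rw [inv_div] at h
    linear_combination h / 2
  linear_combination μ * hℓ + hη + ℓ ^ 2 * hμa

/-- A time-dependent Lyapunov function for the averaged system
`W' = -(k C(W, h, h, h)) h`, where `C` is the quartic form with coefficients `γ₁³`, `γ₂³` and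
`h = heading (Ω t)`; the parameter `μ` is a small weight. -/
def averagedLyapunov (γ₁ γ₂ Ω μ t : ℝ) (w : Plane) : ℝ :=
  dualGauge γ₁ γ₂ w + μ * (Ω⁻¹ * excitationForm (γ₁ ^ 3) (γ₂ ^ 3) (heading (Ω * t)) w w)

lemma abs_averagedLyapunov_sub_dualGauge_le {γ₁ γ₂ μ : ℝ} (hμ : 0 ≤ μ) (t : ℝ) (w : Plane) :
    |averagedLyapunov γ₁ γ₂ Ω μ t w - dualGauge γ₁ γ₂ w|
      ≤ μ * (|Ω⁻¹| * (|γ₁ ^ 3| + |γ₂ ^ 3|) ^ 2) * ‖w‖ ^ 2 := by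
  rw [averagedLyapunov, add_sub_cancel_left, abs_mul, abs_mul, abs_of_nonneg hμ, mul_assoc,
    mul_assoc, sq ‖w‖]
  gcongr
  exact abs_excitationForm_le (norm_heading _).le w w

lemma exists_averagedLyapunov_decrease {γ₁ γ₂ k μ₀ : ℝ} (hγ₁ : 0 < γ₁) (hγ₂ : 0 < γ₂) (hk : 0 < k)
    (hΩ : Ω ≠ 0) (hμ₀ : 0 < μ₀) :
    ∃ μ > 0, μ ≤ μ₀ ∧ ∃ ν > 0, ∃ K ≥ 0, ∀ {W : ℝ → Plane} {e : Plane} {s : Set ℝ} {t : ℝ},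
      HasDerivWithinAt W (-(k * quarticForm (γ₁ ^ 3) (γ₂ ^ 3) (W t) (heading (Ω * t))
        (heading (Ω * t)) (heading (Ω * t))) • heading (Ω * t) + e) s t →
      ∃ D, HasDerivWithinAt (fun τ => averagedLyapunov γ₁ γ₂ Ω μ τ (W τ)) D s t ∧
        D ≤ -ν * ‖W t‖ ^ 2 + K * ‖e‖ ^ 2 := by
  obtain ⟨γ, hγ, h₁, h₂⟩ : ∃ γ > 0, γ ≤ γ₁ ∧ γ ≤ γ₂ :=
    ⟨min γ₁ γ₂, lt_min hγ₁ hγ₂, min_le_left _ _, min_le_right _ _⟩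
  obtain ⟨μ, hμ, hμ₀, K, hK, hweight⟩ := exists_dissipation_weight (4 * √(γ₁ + γ₂) ^ 3)
    (2 * |Ω⁻¹| * (|γ₁ ^ 3| + |γ₂ ^ 3|) ^ 2 * (|k| + 1))
    (by positivity : 0 < k * (4 * √(γ / 2) / (3 * (γ₁ + γ₂) ^ 2)))
    (by positivity : 0 < 5 / 16 * (γ ^ 3) ^ 2) hμ₀
  refine ⟨μ, hμ, hμ₀, μ * (5 / 16 * (γ ^ 3) ^ 2) / 2, by positivity, K, hK,
    fun {W e s t} hW => ⟨_, (hasDerivWithinAt_dualGauge hW).fun_add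
      (((hasDerivWithinAt_excitationForm hW).const_mul Ω⁻¹).const_mul μ), ?_⟩⟩
  have hh : ‖heading (Ω * t)‖ ≤ 1 := (norm_heading _).le
  have hgauge := inner_dualGaugeGrad_averaged_le hγ h₁ h₂ hk.le hh (W t) e
  have hexcitation := mul_le_mul_of_nonneg_left (excitation_averaged_le k hΩ (by positivity)
    (pow_le_pow_left₀ hγ.le h₁ 3) (pow_le_pow_left₀ hγ.le h₂ 3) hh (W t) e) hμ.le
  exact (add_le_add hgauge hexcitation).trans (hweight ‖W t‖ _ ‖e‖)

lemma exists_lyapunov {k : ℝ} (hC₁ : 0 < C₁) (hC₂ : 0 < C₂) (hk : 0 < k) (hΩ : Ω ≠ 0) :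
    ∃ U : ℝ → Plane → ℝ, ∃ m > 0, ∃ M > 0, ∃ q > 0, ∃ K ≥ 0,
      (∀ t w, m * ‖w‖ ^ 2 ≤ U t w) ∧ (∀ t w, U t w ≤ M * ‖w‖ ^ 2) ∧
      ∀ {W : ℝ → Plane} {e : Plane} {s : Set ℝ} {t : ℝ},
        HasDerivWithinAt W (-(k * quarticForm C₁ C₂ (W t) (heading (Ω * t)) (heading (Ω * t))
          (heading (Ω * t))) • heading (Ω * t) + e) s t →
        ∃ D, HasDerivWithinAt (fun τ => U τ (W τ)) D s t ∧ D ≤ -q * U t (W t) + K * ‖e‖ ^ 2 := by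
  have exists_root {C : ℝ} (hC : 0 < C) : ∃ γ > 0, γ ^ 3 = C :=
    ⟨cbrt C, by unfold cbrt; positivity, cbrt_pow_three C⟩
  obtain ⟨γ₁, hγ₁, rfl⟩ := exists_root hC₁
  obtain ⟨γ₂, hγ₂, rfl⟩ := exists_root hC₂
  set S := |Ω⁻¹| * (|γ₁ ^ 3| + |γ₂ ^ 3|) ^ 2
  have : 0 < S := by positivity
  obtain ⟨m, hm, hlow⟩ : ∃ m > 0, ∀ w, m * ‖w‖ ^ 2 ≤ dualGauge γ₁ γ₂ w :=
    ⟨√(min γ₁ γ₂ / 2) ^ 3, by positivity,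
      mul_norm_sq_le_dualGauge (by positivity) (min_le_left _ _) (min_le_right _ _)⟩
  obtain ⟨μ, hμ, hμS, ν, hν, K, hK, hdecrease⟩ :=
    exists_averagedLyapunov_decrease hγ₁ hγ₂ hk hΩ (by positivity : 0 < m / (2 * S))
  have hclose (t : ℝ) (w : Plane) :
      |averagedLyapunov γ₁ γ₂ Ω μ t w - dualGauge γ₁ γ₂ w| ≤ m / 2 * ‖w‖ ^ 2 := by
    refine (abs_averagedLyapunov_sub_dualGauge_le hμ.le t w).trans ?_
    gcongr
    rw [le_div_iff₀ (by positivity)] at hμS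
    linarith
  have hup (t : ℝ) (w : Plane) : averagedLyapunov γ₁ γ₂ Ω μ t w
      ≤ (4 * √(γ₁ + γ₂) ^ 3 + m / 2) * ‖w‖ ^ 2 := by
    linarith [dualGauge_le hγ₁.le hγ₂.le w, le_of_abs_le (hclose t w)]
  refine ⟨averagedLyapunov γ₁ γ₂ Ω μ, m / 2, by positivity, 4 * √(γ₁ + γ₂) ^ 3 + m / 2,
    by positivity, ν / (4 * √(γ₁ + γ₂) ^ 3 + m / 2), by positivity, K, hK,
    fun t w => by linarith [hlow w, neg_le_of_abs_le (hclose t w)], hup, fun {W e s t} hW => ?_⟩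
  obtain ⟨D, hD, hDle⟩ := hdecrease hW
  refine ⟨D, hD, hDle.trans ?_⟩
  have hrate := mul_le_mul_of_nonneg_left (hup t (W t))
    (by positivity : 0 ≤ ν / (4 * √(γ₁ + γ₂) ^ 3 + m / 2))
  rw [← mul_assoc, div_mul_cancel₀ _ (by positivity)] at hrate
  linarith

end Lyapunov

section Averaging

/-- The values at one instant of a dither for a velocity law `db - dA * J`, where `J` is the
measured objective: `db` and `dA` are the derivatives in the fast phase of the periodic signals `b`
and `A`, and `Mᵢⱼ` is a primitive of `bⁱ Aʲ dA` minus its mean. -/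
structure Dither where
  b : ℝ
  db : ℝ
  A : ℝ
  dA : ℝ
  M₁₀ : ℝ
  M₂₀ : ℝ
  M₃₀ : ℝ
  M₁₁ : ℝ
  M₂₁ : ℝ
  M₁₂ : ℝ

namespace Dither

/-- `d` is a dither with phase velocity `ω`. The products `bⁱ Aʲ dA` with `i + j ≤ 3` have zero
mean, except for `b³ dA`, whose mean `κ` drives the averaged system. -/
structure HasDeriv (d : ℝ → Dither) (ω κ : ℝ) (S : Set ℝ) (t : ℝ) : Prop where
  b : HasDerivWithinAt (fun τ => (d τ).b) (ω * (d t).db) S t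
  A : HasDerivWithinAt (fun τ => (d τ).A) (ω * (d t).dA) S t
  M₁₀ : HasDerivWithinAt (fun τ => (d τ).M₁₀) (ω * ((d t).b * (d t).dA)) S t
  M₂₀ : HasDerivWithinAt (fun τ => (d τ).M₂₀) (ω * ((d t).b ^ 2 * (d t).dA)) S t
  M₃₀ : HasDerivWithinAt (fun τ => (d τ).M₃₀) (ω * ((d t).b ^ 3 * (d t).dA - κ)) S t
  M₁₁ : HasDerivWithinAt (fun τ => (d τ).M₁₁) (ω * ((d t).b * (d t).A * (d t).dA)) S t
  M₂₁ : HasDerivWithinAt (fun τ => (d τ).M₂₁) (ω * ((d t).b ^ 2 * (d t).A * (d t).dA)) S t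
  M₁₂ : HasDerivWithinAt (fun τ => (d τ).M₁₂) (ω * ((d t).b * (d t).A ^ 2 * (d t).dA)) S t

end Dither

/-- The values of a quartic polynomial and of its first four derivatives. -/
abbrev Jet : Type := Fin 5 → ℝ

namespace Jet

/-- The jet of the derivative. -/
def shift (j : Jet) : Jet := ![j 1, j 2, j 3, j 4, 0]

/-- The value at distance `r` from the base point of the quartic polynomial with jet `j`. -/
def taylor (j : Jet) (r : ℝ) : ℝ :=
  j 0 + r * j 1 + r ^ 2 / 2 * j 2 + r ^ 3 / 6 * j 3 + r ^ 4 / 24 * j 4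

end Jet

namespace Dither

section Coefficients

variable (d : Dither) (j v : Jet)

/-- Coefficient of `δ` in the near-identity transformation. Each coefficient `corrᵢ` solves the
homological equation of its order: its derivative in the fast phase cancels the terms of order
`δ ^ (i - 4)` of the velocity, up to their mean. -/
def corr₁ : ℝ := d.A * j 0

/-- Coefficient of `δ²` in the near-identity transformation. -/
def corr₂ : ℝ := d.M₁₀ * j 1 + d.A ^ 2 / 2 * (j 0 * j 1)

/-- Coefficient of `δ³` in the near-identity transformation. -/
def corr₃ : ℝ :=
  d.M₂₀ / 2 * j 2 + d.M₁₁ * j 1 ^ 2 + (d.A * d.M₁₀ - d.M₁₁) * (j 0 * j 2)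
    + d.A ^ 3 / 6 * (j 0 * j 1 ^ 2 + j 0 ^ 2 * j 2)

/-- Coefficient of `δ⁴` in the near-identity transformation. -/
def corr₄ : ℝ :=
  d.M₃₀ / 6 * j 3 + (d.M₂₁ + d.M₁₀ ^ 2) / 2 * (j 1 * j 2)
    + (d.A * d.M₂₀ - d.M₂₁) / 2 * (j 0 * j 3) + d.M₁₂ / 2 * j 1 ^ 3
    + (d.A * d.M₁₁ - d.M₁₂ + d.A ^ 2 * d.M₁₀ / 2) * (j 0 * j 1 * j 2)
    + (d.A ^ 2 * d.M₁₀ / 2 - d.A * d.M₁₁ + d.M₁₂ / 2) * (j 0 ^ 2 * j 3)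
    + d.A ^ 4 / 24 * (j 0 * j 1 ^ 3 + 4 * (j 0 ^ 2 * j 1 * j 2) + j 0 ^ 3 * j 3)

/-- The derivative of `corr₁` in the jet variable, in the direction `v`. -/
def dcorr₁ : ℝ := d.A * v 0

/-- The derivative of `corr₂` in the jet variable, in the direction `v`. -/
def dcorr₂ : ℝ := d.M₁₀ * v 1 + d.A ^ 2 / 2 * (v 0 * j 1 + j 0 * v 1)

/-- The derivative of `corr₃` in the jet variable, in the direction `v`. -/
def dcorr₃ : ℝ :=
  d.M₂₀ / 2 * v 2 + d.M₁₁ * (2 * j 1 * v 1)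
    + (d.A * d.M₁₀ - d.M₁₁) * (v 0 * j 2 + j 0 * v 2)
    + d.A ^ 3 / 6 * (v 0 * j 1 ^ 2 + 2 * j 0 * j 1 * v 1 + 2 * j 0 * v 0 * j 2 + j 0 ^ 2 * v 2)

/-- The derivative of `corr₄` in the jet variable, in the direction `v`. -/
def dcorr₄ : ℝ :=
  d.M₃₀ / 6 * v 3 + (d.M₂₁ + d.M₁₀ ^ 2) / 2 * (v 1 * j 2 + j 1 * v 2)
    + (d.A * d.M₂₀ - d.M₂₁) / 2 * (v 0 * j 3 + j 0 * v 3) + d.M₁₂ / 2 * (3 * j 1 ^ 2 * v 1)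
    + (d.A * d.M₁₁ - d.M₁₂ + d.A ^ 2 * d.M₁₀ / 2)
      * (v 0 * j 1 * j 2 + j 0 * v 1 * j 2 + j 0 * j 1 * v 2)
    + (d.A ^ 2 * d.M₁₀ / 2 - d.A * d.M₁₁ + d.M₁₂ / 2) * (2 * j 0 * v 0 * j 3 + j 0 ^ 2 * v 3)
    + d.A ^ 4 / 24 * (v 0 * j 1 ^ 3 + j 0 * (3 * j 1 ^ 2 * v 1)
      + 4 * (2 * j 0 * v 0 * j 1 * j 2 + j 0 ^ 2 * v 1 * j 2 + j 0 ^ 2 * j 1 * v 2)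
      + 3 * j 0 ^ 2 * v 0 * j 3 + j 0 ^ 3 * v 3)

end Coefficients

section HomologicalEquations

variable {ω κ t : ℝ} {S : Set ℝ} {d : ℝ → Dither} {j : ℝ → Jet} {v : Jet}

lemma HasDeriv.corr₁ (hd : HasDeriv d ω κ S t) (hj : HasDerivWithinAt j v S t) :
    HasDerivWithinAt (fun τ => (d τ).corr₁ (j τ))
      (ω * ((d t).dA * j t 0) + (d t).dcorr₁ v) S t := by
  refine (hd.A.fun_mul (hasDerivWithinAt_pi.1 hj 0)).congr_deriv ?_
  simp only [dcorr₁]; ring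

lemma HasDeriv.corr₂ (hd : HasDeriv d ω κ S t) (hj : HasDerivWithinAt j v S t) :
    HasDerivWithinAt (fun τ => (d τ).corr₂ (j τ))
      (ω * ((d t).dA * ((d t).b * j t 1 + (d t).dcorr₁ (j t).shift * j t 0))
        + (d t).dcorr₂ (j t) v) S t := by
  have hj := hasDerivWithinAt_pi.1 hj
  refine ((hd.M₁₀.fun_mul (hj 1)).fun_add
    (((hd.A.fun_pow 2).div_const 2).fun_mul ((hj 0).fun_mul (hj 1)))).congr_deriv ?_
  simp only [dcorr₁, dcorr₂, Jet.shift, Matrix.cons_val]; push_cast; ring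

lemma HasDeriv.corr₃ (hd : HasDeriv d ω κ S t) (hj : HasDerivWithinAt j v S t) :
    HasDerivWithinAt (fun τ => (d τ).corr₃ (j τ))
      (ω * ((d t).dA * ((d t).b ^ 2 / 2 * j t 2 + (d t).dcorr₁ (j t).shift * ((d t).b * j t 1)
          + (d t).dcorr₂ (j t) (j t).shift * j t 0))
        + (d t).dcorr₃ (j t) v) S t := by
  have hj := hasDerivWithinAt_pi.1 hj
  refine (((((hd.M₂₀.div_const 2).fun_mul (hj 2)).fun_add
    (hd.M₁₁.fun_mul ((hj 1).fun_pow 2))).fun_add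
    (((hd.A.fun_mul hd.M₁₀).fun_sub hd.M₁₁).fun_mul ((hj 0).fun_mul (hj 2)))).fun_add
    (((hd.A.fun_pow 3).div_const 6).fun_mul (((hj 0).fun_mul ((hj 1).fun_pow 2)).fun_add
      (((hj 0).fun_pow 2).fun_mul (hj 2))))).congr_deriv ?_
  simp only [dcorr₁, dcorr₂, dcorr₃, Jet.shift, Matrix.cons_val]; push_cast; ring

lemma HasDeriv.corr₄ (hd : HasDeriv d ω κ S t) (hj : HasDerivWithinAt j v S t) :
    HasDerivWithinAt (fun τ => (d τ).corr₄ (j τ))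
      (ω * ((d t).dA * ((d t).b ^ 3 / 6 * j t 3
            + (d t).dcorr₁ (j t).shift * ((d t).b ^ 2 / 2 * j t 2)
            + (d t).dcorr₂ (j t) (j t).shift * ((d t).b * j t 1)
            + (d t).dcorr₃ (j t) (j t).shift * j t 0)
          - κ / 6 * j t 3)
        + (d t).dcorr₄ (j t) v) S t := by
  have hj := hasDerivWithinAt_pi.1 hj
  have h₀₂ := (hj 0).fun_pow 2
  have h₁₃ := (hj 1).fun_pow 3
  have hA₂M₁₀ := ((hd.A.fun_pow 2).fun_mul hd.M₁₀).div_const 2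
  have hAM₁₁ := hd.A.fun_mul hd.M₁₁
  refine ((((((((hd.M₃₀.div_const 6).fun_mul (hj 3)).fun_add
    (((hd.M₂₁.fun_add (hd.M₁₀.fun_pow 2)).div_const 2).fun_mul ((hj 1).fun_mul (hj 2)))).fun_add
    ((((hd.A.fun_mul hd.M₂₀).fun_sub hd.M₂₁).div_const 2).fun_mul
      ((hj 0).fun_mul (hj 3)))).fun_add
    ((hd.M₁₂.div_const 2).fun_mul h₁₃)).fun_add
    (((hAM₁₁.fun_sub hd.M₁₂).fun_add hA₂M₁₀).fun_mul
      (((hj 0).fun_mul (hj 1)).fun_mul (hj 2)))).fun_add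
    (((hA₂M₁₀.fun_sub hAM₁₁).fun_add (hd.M₁₂.div_const 2)).fun_mul
      (h₀₂.fun_mul (hj 3)))).fun_add
    (((hd.A.fun_pow 4).div_const 24).fun_mul
      ((((hj 0).fun_mul h₁₃).fun_add (((h₀₂.fun_mul (hj 1)).fun_mul (hj 2)).const_mul 4)).fun_add
        (((hj 0).fun_pow 3).fun_mul (hj 3))))).congr_deriv ?_
  simp only [dcorr₁, dcorr₂, dcorr₃, dcorr₄, Jet.shift, Matrix.cons_val]; push_cast; ring

end HomologicalEquations

section Corrector

variable (d : Dither) (δ : ℝ) (j v w : Jet)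

/-- The near-identity displacement, divided by `δ`. -/
def corrector : ℝ := d.corr₁ j + δ * d.corr₂ j + δ ^ 2 * d.corr₃ j + δ ^ 3 * d.corr₄ j

/-- The derivative of `corrector` in the jet variable, in the direction `v`. -/
def dcorrector : ℝ :=
  d.dcorr₁ v + δ * d.dcorr₂ j v + δ ^ 2 * d.dcorr₃ j v + δ ^ 3 * d.dcorr₄ j v

lemma dcorrector_smul_add (ζ : ℝ) :
    d.dcorrector δ j (ζ • v + w) = ζ * d.dcorrector δ j v + d.dcorrector δ j w := by
  simp only [dcorrector, dcorr₁, dcorr₂, dcorr₃, dcorr₄, Pi.add_apply, Pi.smul_apply, smul_eq_mul]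
  ring

/-- The part of the drift of the transformed variable that the corrector leaves, beyond the average,
divided by `δ`; `r` is the slow part of the velocity of the jet. -/
def remainder (r : Jet) : ℝ :=
  let g : Jet := ![j 0, d.b * j 1, d.b ^ 2 / 2 * j 2, d.b ^ 3 / 6 * j 3, d.b ^ 4 / 24 * j 4]
  d.dcorrector δ j r
    - d.dA * (g 4 + d.dcorr₁ j.shift * (g 3 + δ * g 4)
      + d.dcorr₂ j j.shift * (g 2 + δ * g 3 + δ ^ 2 * g 4)
      + d.dcorr₃ j j.shift * (g 1 + δ * g 2 + δ ^ 2 * g 3 + δ ^ 3 * g 4)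
      + d.dcorr₄ j j.shift * (g 0 + δ * g 1 + δ ^ 2 * g 2 + δ ^ 3 * g 3 + δ ^ 4 * g 4))

end Corrector

lemma HasDeriv.corrector {δ κ ζ t : ℝ} {S : Set ℝ} {d : ℝ → Dither} {j : ℝ → Jet} {r : Jet}
    (hδ : δ ≠ 0) (hd : HasDeriv d (δ⁻¹ ^ 4) κ S t)
    (hζ : ζ = -(δ⁻¹ ^ 3 * ((d t).dA * (j t).taylor (δ * (d t).b))))
    (hj : HasDerivWithinAt j (ζ • (j t).shift + r) S t) :
    HasDerivWithinAt (fun τ => δ * (d τ).corrector δ (j τ))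
      (-ζ - κ / 6 * j t 3 + δ * (d t).remainder δ (j t) r) S t := by
  refine ((((hd.corr₁ hj).fun_add ((hd.corr₂ hj).const_mul δ)).fun_add
    ((hd.corr₃ hj).const_mul (δ ^ 2))).fun_add
    ((hd.corr₄ hj).const_mul (δ ^ 3))).const_mul δ |>.congr_deriv ?_
  have hlin := (d t).dcorrector_smul_add δ (j t) (j t).shift r ζ
  simp only [dcorrector] at hlin
  simp only [remainder, dcorrector, Jet.taylor, Matrix.cons_val] at hζ ⊢
  generalize (d t).dcorr₁ (j t).shift = L₁ at *
  generalize (d t).dcorr₂ (j t) (j t).shift = L₂ at *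
  generalize (d t).dcorr₃ (j t) (j t).shift = L₃ at *
  generalize (d t).dcorr₄ (j t) (j t).shift = L₄ at *
  generalize ζ • (j t).shift + r = V at *
  rw [show (d t).dcorr₁ V = _ from eq_sub_of_add_eq (by simpa only [add_assoc] using hlin), hζ]
  field_simp
  ring

end Dither

end Averaging

section NearIdentity

/-- The dither `b = β sin θ`, `dA = -α sin 3θ` as a function of the unit vector
`e = (cos θ, sin θ)`: its primitives are polynomials in the coordinates of `e`. -/
def cubicDither (α β : ℝ) (e : Plane) : Dither where
  b := β * e 1
  db := β * e 0
  A := α / 3 * (e 0 * (1 - 4 * e 1 ^ 2))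
  dA := -(α * (3 * e 1 - 4 * e 1 ^ 3))
  M₁₀ := -(α * β) * (e 1 ^ 3 * e 0)
  M₂₀ := -(α * β ^ 2) * (e 0 - 5 / 3 * e 0 ^ 3 + 4 / 5 * e 0 ^ 5)
  M₃₀ := -(α * β ^ 3) * (e 0 * (e 1 / 8 + e 1 ^ 3 / 12 + 2 / 3 * e 1 ^ 5))
  M₁₁ := -(α ^ 2 * β / 3) * (e 1 ^ 3 - 16 / 5 * e 1 ^ 5 + 16 / 7 * e 1 ^ 7)
  M₂₁ := -(α ^ 2 * β ^ 2 / 3) * (3 / 4 * e 1 ^ 4 - 8 / 3 * e 1 ^ 6 + 2 * e 1 ^ 8)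
  M₁₂ := -(α ^ 3 * β / 9) *
    (e 0 * (e 1 ^ 3 - 27 / 5 * e 1 ^ 5 + 54 / 5 * e 1 ^ 7 - 32 / 5 * e 1 ^ 9))

lemma hasDeriv_cubicDither (α β ω : ℝ) (S : Set ℝ) (t : ℝ) :
    Dither.HasDeriv (fun τ => cubicDither α β (heading (ω * τ))) ω (α * β ^ 3 / 8) S t := by
  have hs := hasDerivWithinAt_heading_apply_one ω S t
  have hk := hasDerivWithinAt_heading_apply_zero ω S t
  have h1 : heading (ω * t) 0 ^ 2 = 1 - heading (ω * t) 1 ^ 2 := cos_sq' _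
  have h2 : heading (ω * t) 0 ^ 4 = (1 - heading (ω * t) 1 ^ 2) ^ 2 := by rw [← h1]; ring
  have p (n : ℕ) := hs.fun_pow n
  have q (n : ℕ) := hk.fun_pow n
  constructor
  · exact (hs.const_mul β).congr_deriv (mul_left_comm _ _ _)
  · refine ((hk.fun_mul (((p 2).const_mul 4).const_sub 1)).const_mul (α / 3)).congr_deriv ?_
    simp only [cubicDither]; push_cast; ring_nf; simp only [h1]; ring
  · refine (((p 3).fun_mul hk).const_mul (-(α * β))).congr_deriv ?_
    simp only [cubicDither]; push_cast; ring_nf; simp only [h1]; ring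
  · refine (((hk.fun_sub ((q 3).const_mul (5 / 3))).fun_add
      ((q 5).const_mul (4 / 5))).const_mul (-(α * β ^ 2))).congr_deriv ?_
    simp only [cubicDither]; push_cast; ring_nf; simp only [h1, h2]; ring
  · refine ((hk.fun_mul (((hs.div_const 8).fun_add ((p 3).div_const 12)).fun_add
      ((p 5).const_mul (2 / 3)))).const_mul (-(α * β ^ 3))).congr_deriv ?_
    simp only [cubicDither]; push_cast; ring_nf; simp only [h1]; ring
  · refine ((((p 3).fun_sub ((p 5).const_mul (16 / 5))).fun_add
      ((p 7).const_mul (16 / 7))).const_mul (-(α ^ 2 * β / 3))).congr_deriv ?_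
    simp only [cubicDither]; push_cast; ring
  · refine (((((p 4).const_mul (3 / 4)).fun_sub ((p 6).const_mul (8 / 3))).fun_add
      ((p 8).const_mul 2)).const_mul (-(α ^ 2 * β ^ 2 / 3))).congr_deriv ?_
    simp only [cubicDither]; push_cast; ring
  · refine ((hk.fun_mul ((((p 3).fun_sub ((p 5).const_mul (27 / 5))).fun_add
      ((p 7).const_mul (54 / 5))).fun_sub
        ((p 9).const_mul (32 / 5)))).const_mul (-(α ^ 3 * β / 9))).congr_deriv ?_
    simp only [cubicDither]; push_cast; ring_nf; simp only [h1]; ring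

/-- The derivatives at `0` of `s ↦ quarticForm C₁ C₂ (z + s • h) (z + s • h) (z + s • h)
(z + s • h)`. -/
def quarticJet (C₁ C₂ : ℝ) (z h : Plane) : Jet :=
  ![quarticForm C₁ C₂ z z z z, 4 * quarticForm C₁ C₂ z z z h, 12 * quarticForm C₁ C₂ z z h h,
    24 * quarticForm C₁ C₂ z h h h, 24 * quarticForm C₁ C₂ h h h h]

/-- The derivative of `quarticJet C₁ C₂` at `(z, h)` in the direction `(n, k)`. -/
def quarticJetDeriv (C₁ C₂ : ℝ) (z h n k : Plane) : Jet :=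
  ![4 * quarticForm C₁ C₂ z z z n,
    12 * quarticForm C₁ C₂ z z h n + 4 * quarticForm C₁ C₂ z z z k,
    24 * quarticForm C₁ C₂ z h h n + 24 * quarticForm C₁ C₂ z z h k,
    24 * quarticForm C₁ C₂ h h h n + 72 * quarticForm C₁ C₂ z h h k,
    96 * quarticForm C₁ C₂ h h h k]

lemma taylor_quarticJet (C₁ C₂ r : ℝ) (z h : Plane) :
    (quarticJet C₁ C₂ z h).taylor r =
      quarticForm C₁ C₂ (z + r • h) (z + r • h) (z + r • h) (z + r • h) := by
  simp only [Jet.taylor, quarticJet, Matrix.cons_val, quarticForm, PiLp.add_apply, PiLp.smul_apply,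
    smul_eq_mul]
  ring

lemma hasDerivWithinAt_quarticJet {C₁ C₂ ζ t : ℝ} {S : Set ℝ} {z h : ℝ → Plane} {n k : Plane}
    (hz : HasDerivWithinAt z (ζ • h t + n) S t) (hh : HasDerivWithinAt h k S t) :
    HasDerivWithinAt (fun τ => quarticJet C₁ C₂ (z τ) (h τ))
      (ζ • (quarticJet C₁ C₂ (z t) (h t)).shift + quarticJetDeriv C₁ C₂ (z t) (h t) n k) S t := by
  have h₀ := hasDerivWithinAt_quarticForm (C₁ := C₁) (C₂ := C₂) hz hz hz hz
  have h₁ := hasDerivWithinAt_quarticForm (C₁ := C₁) (C₂ := C₂) hz hz hz hh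
  have h₂ := hasDerivWithinAt_quarticForm (C₁ := C₁) (C₂ := C₂) hz hz hh hh
  have h₃ := hasDerivWithinAt_quarticForm (C₁ := C₁) (C₂ := C₂) hz hh hh hh
  have h₄ := hasDerivWithinAt_quarticForm (C₁ := C₁) (C₂ := C₂) hh hh hh hh
  refine hasDerivWithinAt_pi.2 fun i => ?_
  fin_cases i
  map_tacs [refine h₀.congr_deriv ?_; refine (h₁.const_mul 4).congr_deriv ?_;
    refine (h₂.const_mul 12).congr_deriv ?_; refine (h₃.const_mul 24).congr_deriv ?_;
    refine (h₄.const_mul 24).congr_deriv ?_]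
  all_goals
    simp only [quarticJet, quarticJetDeriv, Jet.shift, quarticForm, Pi.add_apply, Pi.smul_apply,
      PiLp.add_apply, PiLp.smul_apply, smul_eq_mul, Fin.zero_eta, Fin.mk_one, Fin.reduceFinMk,
      Matrix.cons_val]
    ring

/-- The displacement along the heading `h` by which the near-identity transformation moves the
position, divided by `δ`; the position relative to the minimizer is `z + (δ * d.b) • h`. -/
def displacement (C₁ C₂ δ : ℝ) (d : Dither) (z h : Plane) : ℝ :=
  d.corrector δ (quarticJet C₁ C₂ z h) - d.b

/-- The deviation of the velocity of the transformed position from the averaged velocity, divided by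
`δ`; the heading `h` turns with velocity `k`. -/
def defect (C₁ C₂ κ δ : ℝ) (d : Dither) (z h k : Plane) : Plane :=
  (d.remainder δ (quarticJet C₁ C₂ z h) (quarticJetDeriv C₁ C₂ z h (-(δ * d.b) • k) k)
      + 4 * κ * d.corrector δ (quarticJet C₁ C₂ z h) * quarticForm C₁ C₂ h h h h) • h
    + displacement C₁ C₂ δ d z h • k

section Transformation

variable {C₁ C₂ κ δ t : ℝ} {S : Set ℝ} {d : ℝ → Dither} {Y Z h : ℝ → Plane} {k : Plane}

lemma hasDerivWithinAt_sub_dither (hδ : δ ≠ 0) (hd : Dither.HasDeriv d (δ⁻¹ ^ 4) κ S t)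
    (hh : HasDerivWithinAt h k S t) (hZ : ∀ τ, Z τ = Y τ - (δ * (d τ).b) • h τ)
    (hY : HasDerivWithinAt Y
      ((δ⁻¹ ^ 3 * ((d t).db - (d t).dA * quarticForm C₁ C₂ (Y t) (Y t) (Y t) (Y t))) • h t) S t) :
    HasDerivWithinAt Z
      (-(δ⁻¹ ^ 3 * ((d t).dA * (quarticJet C₁ C₂ (Z t) (h t)).taylor (δ * (d t).b))) • h t
        + -(δ * (d t).b) • k) S t := by
  have hYZ : Z t + (δ * (d t).b) • h t = Y t := by rw [hZ, sub_add_cancel]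
  rw [taylor_quarticJet, hYZ, funext hZ]
  refine (hY.fun_sub ((hd.b.const_mul δ).fun_smul hh)).congr_deriv ?_
  match_scalars <;> field_simp
  ring

lemma hasDerivWithinAt_nearIdentity (hδ : δ ≠ 0) (hd : Dither.HasDeriv d (δ⁻¹ ^ 4) κ S t)
    (hh : HasDerivWithinAt h k S t) (hZ : ∀ τ, Z τ = Y τ - (δ * (d τ).b) • h τ)
    (hY : HasDerivWithinAt Y
      ((δ⁻¹ ^ 3 * ((d t).db - (d t).dA * quarticForm C₁ C₂ (Y t) (Y t) (Y t) (Y t))) • h t) S t)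
    {W : ℝ → Plane} (hW : ∀ τ, W τ = Y τ + (δ * displacement C₁ C₂ δ (d τ) (Z τ) (h τ)) • h τ) :
    HasDerivWithinAt W (-(4 * κ * quarticForm C₁ C₂ (W t) (h t) (h t) (h t)) • h t
      + δ • defect C₁ C₂ κ δ (d t) (Z t) (h t) k) S t := by
  have hZ' := hasDerivWithinAt_sub_dither hδ hd hh hZ hY
  have hU := hd.corrector hδ rfl (hasDerivWithinAt_quarticJet hZ' hh)
  have hWZ : ∀ τ, W τ =
      Z τ + (δ * (d τ).corrector δ (quarticJet C₁ C₂ (Z τ) (h τ))) • h τ := fun τ => by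
    rw [hW, hZ, displacement]
    module
  have hqW : quarticForm C₁ C₂ (W t) (h t) (h t) (h t) = quarticForm C₁ C₂ (Z t) (h t) (h t) (h t)
      + δ * (d t).corrector δ (quarticJet C₁ C₂ (Z t) (h t))
        * quarticForm C₁ C₂ (h t) (h t) (h t) (h t) := by
    simp only [hWZ, quarticForm, PiLp.add_apply, PiLp.smul_apply, smul_eq_mul]
    ring
  have hj₃ : quarticJet C₁ C₂ (Z t) (h t) 3 = 24 * quarticForm C₁ C₂ (Z t) (h t) (h t) (h t) := rfl
  rw [hqW, funext hWZ]
  refine (hZ'.fun_add (hU.fun_smul hh)).congr_deriv ?_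
  rw [hj₃, defect, displacement]
  match_scalars <;> ring

end Transformation

lemma continuous_displacement_cubicDither (α β C₁ C₂ : ℝ) :
    Continuous fun p : ℝ × Plane × Plane × Plane =>
      displacement C₁ C₂ p.1 (cubicDither α β p.2.1) p.2.2.1 p.2.2.2 := by
  simp only [displacement, Dither.corrector, Dither.corr₁, Dither.corr₂, Dither.corr₃, Dither.corr₄,
    cubicDither, quarticJet, quarticForm, Matrix.cons_val]
  fun_prop

lemma continuous_defect_cubicDither (α β C₁ C₂ κ : ℝ) :
    Continuous fun p : ℝ × Plane × Plane × Plane × Plane =>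
      defect C₁ C₂ κ p.1 (cubicDither α β p.2.1) p.2.2.1 p.2.2.2.1 p.2.2.2.2 := by
  simp only [defect, Dither.remainder, Dither.dcorrector, Dither.dcorr₁, Dither.dcorr₂,
    Dither.dcorr₃, Dither.dcorr₄, displacement, Dither.corrector, Dither.corr₁, Dither.corr₂,
    Dither.corr₃, Dither.corr₄, cubicDither, quarticJet, quarticJetDeriv, Jet.shift, quarticForm,
    Matrix.cons_val, PiLp.smul_apply]
  fun_prop

lemma exists_bound_displacement_defect (α β C₁ C₂ κ B : ℝ) :
    ∃ K > 0, ∀ δ e z h k, |δ| ≤ B → ‖e‖ ≤ B → ‖z‖ ≤ B → ‖h‖ ≤ B → ‖k‖ ≤ B →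
      |displacement C₁ C₂ δ (cubicDither α β e) z h| ≤ K ∧
        ‖defect C₁ C₂ κ δ (cubicDither α β e) z h k‖ ≤ K := by
  obtain ⟨K₁, hK₁⟩ := (isCompact_closedBall 0 B).exists_bound_of_continuousOn
    (continuous_displacement_cubicDither α β C₁ C₂).continuousOn
  obtain ⟨K₂, hK₂⟩ := (isCompact_closedBall 0 B).exists_bound_of_continuousOn
    (continuous_defect_cubicDither α β C₁ C₂ κ).continuousOn
  refine ⟨max 1 (max K₁ K₂), by positivity, fun δ e z h k hδ he hz hh hk => ⟨?_, ?_⟩⟩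
  · exact (hK₁ (δ, e, z, h) (by simp [Prod.norm_def, *])).trans (by simp)
  · exact (hK₂ (δ, e, z, h, k) (by simp [Prod.norm_def, *])).trans (by simp)

theorem exists_nearIdentity (α β C₁ C₂ Ω R : ℝ) :
    ∃ K > 0, ∀ δ ∈ Ioc (0 : ℝ) 1, ∀ (Y : ℝ → Plane) (S : Set ℝ),
      (∀ t ∈ S, ‖Y t‖ ≤ R ∧ HasDerivWithinAt Y
        ((δ⁻¹ ^ 3 * ((cubicDither α β (heading (δ⁻¹ ^ 4 * t))).db
          - (cubicDither α β (heading (δ⁻¹ ^ 4 * t))).dA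
            * quarticForm C₁ C₂ (Y t) (Y t) (Y t) (Y t))) • heading (Ω * t)) S t) →
      ∃ W : ℝ → Plane, ∀ t ∈ S, ‖W t - Y t‖ ≤ K * δ ∧ ∃ e : Plane, ‖e‖ ≤ K * δ ∧
        HasDerivWithinAt W (-(4 * (α * β ^ 3 / 8) * quarticForm C₁ C₂ (W t) (heading (Ω * t))
          (heading (Ω * t)) (heading (Ω * t))) • heading (Ω * t) + e) S t := by
  obtain ⟨K, hK, hbound⟩ :=
    exists_bound_displacement_defect α β C₁ C₂ (α * β ^ 3 / 8) (max (max 1 |Ω|) (R + |β|))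
  refine ⟨K, hK, fun δ hδ Y S hY => ?_⟩
  have hδ1 : |δ| ≤ 1 := by rw [abs_of_pos hδ.1]; exact hδ.2
  let d : ℝ → Dither := fun t => cubicDither α β (heading (δ⁻¹ ^ 4 * t))
  let Z : ℝ → Plane := fun t => Y t - (δ * (d t).b) • heading (Ω * t)
  refine ⟨fun t => Y t + (δ * displacement C₁ C₂ δ (d t) (Z t) (heading (Ω * t))) • heading (Ω * t),
    fun t ht => ?_⟩
  obtain ⟨hYR, hY'⟩ := hY t ht
  have hb : |(d t).b| ≤ |β| :=
    (abs_mul _ _).trans_le (mul_le_of_le_one_right (abs_nonneg β) (abs_sin_le_one _))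
  have hZ : ‖Z t‖ ≤ R + |β| := by
    refine (norm_sub_le _ _).trans (add_le_add hYR ?_)
    rw [norm_smul, norm_heading, mul_one, norm_mul]
    exact (mul_le_of_le_one_left (norm_nonneg _) hδ1).trans hb
  obtain ⟨hdisp, hdefect⟩ := hbound δ (heading (δ⁻¹ ^ 4 * t)) (Z t) (heading (Ω * t))
    (Ω • heading (Ω * t + π / 2)) (by simp [hδ1]) (by simp [norm_heading]) (by simp [hZ])
    (by simp [norm_heading]) (by simp [norm_smul, norm_heading])
  refine ⟨?_, _, ?_, hasDerivWithinAt_nearIdentity hδ.1.ne' (hasDeriv_cubicDither α β _ S t)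
    (hasDerivWithinAt_heading Ω S t) (fun _ => rfl) hY' (fun _ => rfl)⟩
  · rw [add_sub_cancel_left, norm_smul, norm_heading, mul_one, norm_mul, norm_of_nonneg hδ.1.le,
      mul_comm]
    exact mul_le_mul_of_nonneg_right hdisp hδ.1.le
  · rw [norm_smul, norm_of_nonneg hδ.1.le, mul_comm]
    exact mul_le_mul_of_nonneg_right hdefect hδ.1.le

end NearIdentity

section Unicycle

/-- The size `(ε / 2π)^(1/4)` of the dither: its inverse fourth power is the dither frequency. -/
def ditherScale (ε : ℝ) : ℝ := (ε / (2 * π)) ^ (1 / 4 : ℝ)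

lemma ditherScale_pos {ε : ℝ} (hε : 0 < ε) : 0 < ditherScale ε := by
  unfold ditherScale
  positivity

lemma ditherScale_inv_pow_four {ε : ℝ} (hε : 0 < ε) : (ditherScale ε)⁻¹ ^ 4 = 2 * π / ε := by
  have h : 0 ≤ ε / (2 * π) := by positivity
  rw [ditherScale, inv_pow, ← rpow_natCast, ← rpow_mul h]
  norm_num

lemma ditherScale_inv_pow_three {ε : ℝ} (hε : 0 < ε) :
    (ditherScale ε)⁻¹ ^ 3 = (2 * π / ε) ^ (3 / 4 : ℝ) := by
  have h : 0 ≤ ε / (2 * π) := by positivity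
  rw [ditherScale, inv_pow, ← rpow_natCast, ← rpow_mul h, ← inv_rpow h, inv_div]
  norm_num

lemma tendsto_ditherScale : Tendsto ditherScale (𝓝[>] 0) (𝓝 0) := by
  have hcont : Continuous ditherScale :=
    (continuous_id.div_const _).rpow_const fun _ => Or.inr (by norm_num)
  have hzero : ditherScale 0 = 0 := by simp [ditherScale]
  exact (hcont.tendsto' 0 0 hzero).mono_left nhdsWithin_le_nhds

lemma velocityLaw_eq_cubicDither (c a : ℝ) {ε : ℝ} (hε : 0 < ε) (t J : ℝ) :
    velocityLaw c a ε t J = (ditherScale ε)⁻¹ ^ 3 *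
      ((cubicDither (6 * c) (2 * a) (heading ((ditherScale ε)⁻¹ ^ 4 * t))).db
        - (cubicDither (6 * c) (2 * a) (heading ((ditherScale ε)⁻¹ ^ 4 * t))).dA * J) := by
  have htriple : sin (6 * π * t / ε)
      = 3 * sin (2 * π / ε * t) - 4 * sin (2 * π / ε * t) ^ 3 := by
    rw [← sin_three_mul]; congr 1; ring
  have hangle : 2 * π * t / ε = 2 * π / ε * t := mul_div_right_comm _ _ _
  rw [velocityLaw, htriple, hangle, ditherScale_inv_pow_three hε, ditherScale_inv_pow_four hε]
  simp only [cubicDither, heading, PiLp.toLp_apply, Matrix.cons_val]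
  ring

lemma exists_lipschitz_bound_velocityLaw (c a ε : ℝ) {K B : NNReal} {g : Plane → ℝ}
    (hK : LipschitzWith K g) (hB : ∀ X, ‖g X‖ ≤ B) :
    ∃ K' L : NNReal, (∀ t, LipschitzWith K' fun X => velocityLaw c a ε t (g X)) ∧
      ∀ t X, ‖velocityLaw c a ε t (g X)‖ ≤ L := by
  set A := 2 * (2 * π / ε) ^ (3 / 4 : ℝ) with hA
  refine ⟨‖A * (3 * c)‖₊ * K, ‖A‖₊ * (‖3 * c‖₊ * B + ‖a‖₊), fun t => ?_, fun t X => ?_⟩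
  · refine LipschitzWith.of_dist_le_mul fun X Y => ?_
    have hdiff : velocityLaw c a ε t (g X) - velocityLaw c a ε t (g Y)
        = A * (3 * c) * (g X - g Y) * sin (6 * π * t / ε) := by
      simp only [velocityLaw, ← hA]; ring
    rw [dist_eq_norm, hdiff, norm_mul, norm_mul, NNReal.coe_mul, coe_nnnorm,
      mul_assoc _ _ (dist _ _)]
    exact (mul_le_of_le_one_right (by positivity) (abs_sin_le_one _)).trans
      (mul_le_mul_of_nonneg_left (hK.dist_le_mul X Y) (norm_nonneg _))
  · rw [velocityLaw, ← hA, norm_mul]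
    push_cast
    gcongr
    refine (norm_add_le _ _).trans (add_le_add ?_ ?_) <;> rw [norm_mul]
    · refine (mul_le_of_le_one_right (norm_nonneg _) (abs_sin_le_one _)).trans ?_
      rw [norm_mul]
      exact mul_le_mul_of_nonneg_left (hB X) (norm_nonneg _)
    · exact mul_le_of_le_one_right (norm_nonneg _) (abs_cos_le_one _)

variable (C₁ C₂ c a Ω : ℝ) (Xd : Plane)

lemma exists_solution_while_mem_closedBall (R ε : ℝ) (X₀ : Plane) {T : ℝ} (hT : 0 ≤ T) :
    ∃ X : ℝ → Plane, X 0 = X₀ ∧ ContinuousOn X (Icc 0 T) ∧ ∀ t ∈ Icc 0 T, ‖X t - Xd‖ ≤ R →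
      HasDerivWithinAt X (unicycleField C₁ C₂ c a Ω Xd ε t (X t)) (Icc 0 T) t := by
  have hJ : ContDiff ℝ 1 (objective C₁ C₂ Xd) := by
    unfold objective
    fun_prop
  obtain ⟨g, K, B, hK, hB, hg⟩ := exists_bounded_lipschitz_eqOn_closedBall hJ Xd R
  obtain ⟨K', L, hK', hL⟩ := exists_lipschitz_bound_velocityLaw c a ε hK hB
  let f : ℝ → Plane → Plane := fun t X => velocityLaw c a ε t (g X) • heading (Ω * t)
  have hfK : ∀ t, LipschitzWith K' (f t) := fun t => LipschitzWith.of_dist_le_mul fun X Y => by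
    rw [dist_eq_norm, ← sub_smul, norm_smul, norm_heading, mul_one, ← dist_eq_norm]
    exact (hK' t).dist_le_mul X Y
  have hfc : ∀ X, Continuous fun t => f t X := fun X => by
    have hv : Continuous fun t => velocityLaw c a ε t (g X) := by
      unfold velocityLaw
      fun_prop
    exact hv.smul (continuous_heading.comp (continuous_const_mul Ω))
  have hfL : ∀ t X, ‖f t X‖ ≤ L := fun t X => by
    rw [norm_smul, norm_heading, mul_one]
    exact hL t X
  obtain ⟨X, hX0, hX⟩ := exists_solution_of_bounded_lipschitz hfK hfc hfL X₀ hT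
  refine ⟨X, hX0, fun t ht => (hX t ht).continuousWithinAt, fun t ht hR => ?_⟩
  rw [unicycleField_eq_smul_heading, ← hg (mem_closedBall_iff_norm.2 hR)]
  exact hX t ht

variable {C₁ C₂ c a Ω}

theorem exists_apriori_estimate (hC₁ : 0 < C₁) (hC₂ : 0 < C₂) (hca : 0 < c * a) (hΩ : Ω ≠ 0) :
    ∃ q₁ > 0, ∃ q₂ > 0, ∀ R, ∃ K > 0, ∀ ε > 0, ditherScale ε ≤ 1 → ∀ (T : ℝ) (X : ℝ → Plane),
      (∀ t ∈ Icc 0 T, ‖X t - Xd‖ ≤ R ∧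
        HasDerivWithinAt X (unicycleField C₁ C₂ c a Ω Xd ε t (X t)) (Icc 0 T) t) →
      ∀ t ∈ Icc 0 T, ‖X t - Xd‖ ≤ q₁ * ‖X 0 - Xd‖ * exp (-(q₂ * t)) + K * ditherScale ε := by
  have hgain : 0 < 4 * (6 * c * (2 * a) ^ 3 / 8) := by
    have : a ≠ 0 := right_ne_zero_of_mul hca.ne'
    calc 0 < 24 * (c * a * a ^ 2) := by positivity
      _ = 4 * (6 * c * (2 * a) ^ 3 / 8) := by ring
  obtain ⟨U, m, hm, M, hM, q, hq, L, hL, hlow, hup, hU⟩ := exists_lyapunov hC₁ hC₂ hgain hΩ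
  refine ⟨√(M / m), by positivity, q / 2, by positivity, fun R => ?_⟩
  obtain ⟨K, hK, hnear⟩ := exists_nearIdentity (6 * c) (2 * a) C₁ C₂ Ω R
  refine ⟨√(M / m) * K + √(L / (q * m)) * K + K, by positivity, fun ε hε hδ1 T X hX t ht => ?_⟩
  set δ := ditherScale ε
  have hδ0 : 0 < δ := ditherScale_pos hε
  obtain ⟨W, hW⟩ := hnear δ ⟨hδ0, hδ1⟩ (fun τ => X τ - Xd) (Icc 0 T) fun τ hτ =>
    ⟨(hX τ hτ).1, ((hX τ hτ).2.sub_const Xd).congr_deriv (by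
      rw [unicycleField_eq_smul_heading, velocityLaw_eq_cubicDither c a hε,
        objective_eq_quarticForm])⟩
  have hWdecay : ‖W t‖ ≤ √(M / m) * ‖W 0‖ * exp (-(q / 2 * t)) + √(L / (q * m)) * (K * δ) := by
    refine norm_le_exp_decay_of_lyapunov hm hM.le hq hL (by positivity) (fun τ => hlow τ (W τ))
      (fun τ => hup τ (W τ)) (fun τ hτ => ?_) ht
    obtain ⟨-, e, he, hW'⟩ := hW τ hτ
    obtain ⟨D, hD, hDle⟩ := hU hW'
    exact ⟨D, hD, hDle.trans (by gcongr)⟩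
  have hXdecay := norm_le_exp_decay_of_near (Y := fun τ => X τ - Xd) (by positivity) (by positivity)
    ht.1 hWdecay fun τ hτ => (hW τ ⟨hτ.1, hτ.2.trans ht.2⟩).1
  exact hXdecay.trans_eq (by ring)

lemma confined_of_apriori_estimate {f : ℝ → Plane → Plane} {X : ℝ → Plane} {q₁ q₂ r δ T : ℝ}
    (hq₁ : 0 < q₁) (hq₂ : 0 < q₂) (hδ : δ < 1) (h0 : ‖X 0 - Xd‖ ≤ r)
    (hX : ContinuousOn X (Icc 0 T))
    (hf : ∀ t ∈ Icc 0 T, ‖X t - Xd‖ ≤ q₁ * r + r + 1 → HasDerivWithinAt X (f t (X t)) (Icc 0 T) t)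
    (hest : ∀ t₁, (∀ t ∈ Icc 0 t₁, ‖X t - Xd‖ ≤ q₁ * r + r + 1 ∧
        HasDerivWithinAt X (f t (X t)) (Icc 0 t₁) t) →
      ∀ t ∈ Icc 0 t₁, ‖X t - Xd‖ ≤ q₁ * ‖X 0 - Xd‖ * exp (-(q₂ * t)) + δ) :
    ∀ t ∈ Icc 0 T, ‖X t - Xd‖ < q₁ * r + r + 1 := by
  have hr : 0 ≤ r := (norm_nonneg _).trans h0
  have hq₁r : 0 ≤ q₁ * r := by positivity
  refine lt_of_forall_le_imp_lt (by fun_prop) (by linarith) fun t₁ ht₁ hle => ?_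
  have hbound := hest t₁ (fun t ht => ⟨hle t ht, (hf t ⟨ht.1, ht.2.trans ht₁.2⟩ (hle t ht)).mono
    (Icc_subset_Icc_right ht₁.2)⟩) t₁ ⟨ht₁.1, le_rfl⟩
  have hexp : exp (-(q₂ * t₁)) ≤ 1 := by
    have := ht₁.1
    exact exp_le_one_iff.2 (neg_nonpos.2 (by positivity))
  calc ‖X t₁ - Xd‖ ≤ q₁ * r * 1 + δ := hbound.trans (by gcongr)
    _ < q₁ * r + r + 1 := by linarith

theorem theorem2_general (hC₁ : 0 < C₁) (hC₂ : 0 < C₂) (hca : 0 < c * a) (hΩ : Ω ≠ 0)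
    {D : Set Plane} (hD : Bornology.IsBounded D) :
    IsPracticallyExpStable (unicycleField C₁ C₂ c a Ω Xd) Xd D := by
  obtain ⟨q₁, hq₁, q₂, hq₂, hest⟩ := exists_apriori_estimate Xd hC₁ hC₂ hca hΩ
  obtain ⟨r, hr⟩ := hD.subset_closedBall Xd
  obtain ⟨K, -, hK⟩ := hest (q₁ * r + r + 1)
  have hlim : Tendsto (fun ε => K * ditherScale ε) (𝓝[>] 0) (𝓝 0) := by
    simpa using tendsto_ditherScale.const_mul K
  obtain ⟨ε₀, hε₀, hsmall⟩ := mem_nhdsGT_iff_exists_Ioo_subset.1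
    ((tendsto_ditherScale.eventually_lt_const one_pos).and (hlim.eventually_lt_const one_pos))
  refine ⟨q₁, hq₁, q₂, hq₂, _, hlim, ε₀, hε₀, fun ε hε X₀ hX₀ T hT => ?_⟩
  obtain ⟨hδ, hKδ⟩ := hsmall hε
  have hX₀r : ‖X₀ - Xd‖ ≤ r := mem_closedBall_iff_norm.1 (hr hX₀)
  constructor
  · obtain ⟨X, rfl, hcont, hX⟩ :=
      exists_solution_while_mem_closedBall C₁ C₂ c a Ω Xd (q₁ * r + r + 1) ε X₀ hT.le
    have hconf := confined_of_apriori_estimate Xd hq₁ hq₂ hKδ hX₀r hcont hX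
      fun t₁ => hK ε hε.1 hδ.le t₁ X
    exact ⟨X, rfl, fun t ht => hX t ht (hconf t ht).le⟩
  · rintro X ⟨rfl, hX⟩
    have hconf := confined_of_apriori_estimate Xd hq₁ hq₂ hKδ hX₀r
      (fun t ht => (hX t ht).continuousWithinAt) (fun t ht _ => hX t ht)
      fun t₁ => hK ε hε.1 hδ.le t₁ X
    exact hK ε hε.1 hδ.le T X fun t ht => ⟨(hconf t ht).le, hX t ht⟩

end Unicycle

end

theorem theorem2 (C₁ C₂ c a Ω : ℝ) (hC₁ : 0 < C₁) (hC₂ : 0 < C₂) (hc : 0 < c) (ha : 0 < a)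
    (hΩ : Ω ≠ 0) (Xd : Plane) (D : Set Plane) (hD : IsCompact D) (hXd : Xd ∈ D) :
    IsPracticallyExpStable (unicycleField C₁ C₂ c a Ω Xd) Xd D :=
  theorem2_general Xd hC₁ hC₂ (mul_pos hc ha) hΩ hD.isBounded
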